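/- Theorem 3 (the optimal stopping rule for network aware decision making is a network-state-dependent threshold rule). **Network.** Time is slotted. $N\ge 1$ sensors sample synchronously every $m=1/r\in\{1,2,\dots\}$ slots; batch $b\ge1$ is sampled at time $bm$. Each sensor $i$ keeps its samples in a FIFO queue, of length $L^{(i)}_k$ just after the beginning of slot $k$, with $L^{(i)}_0=0$. If $n\ge 1$ queues are nonempty in slot $k$, then with probability $\sigma\in(0,1)$ one packet is successfully transmitted, from a node chosen uniformly among these $n$ nodes; otherwise no packet is transmitted. Let $M_k\in\{0,1,\dots,N\}$ be the transmitting node ($0$ if none); a sample transmitted in slot $k$ reaches the fusion center at time $k+1$. There the samples are handed to the decision maker batch by batch: a received sample of the batch currently being processed is handed over at once, samples of later batches wait in sequencing queues, and when the last component of the current batch arrives, the head-of-line sequenced samples (those of the next batch) are handed over with it and the next batch becomes the current one. Let $B_k$ be the index of the current batch ($B_0=1$), $W^{(i)}_k$ the length of the $i$-th sequencing queue, $R^{(i)}_k\in\{0,1\}$ the indicator that component $i$ of batch $B_k$ has been received by the decision maker, $\lambda_k=m-(k\bmod m)$, $\Delta_k=\max\{k-B_km,0\}$, and let $Q_k=[\lambda_k,B_k,\Delta_k,W_k,R_k]$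 be the observable queueing state. **Change and observations.** The change time $T$ satisfies $P(T=0)=\rho\in[0,1]$ and $P(T=k)=(1-\rho)p(1-p)^{k-1}$ for $k\ge1$, with $0<p<1$. Given $T$, the samples $X^{(i)}_b$ are independent, with law $F_0$ if $bm<T$ and $F_1$ if $bm\ge T$ ($F_0,F_1$ arbitrary probability measures on a measurable space). The process $(M_k)$ is independent of $T$ and of the samples. At time $k$ the decision maker observes $Z_k=[Q_k,Y_k]$, where $Y_k$ is the (possibly empty) vector of samples handed over at time $k$; let $\mathcal I_k=\sigma(Z_0,\dots,Z_k)$ and $\Pi_k=P(T\le k\mid \mathcal I_k)$. **Claim.** Fix $N,m,\sigma,p,F_0,F_1$ and a delay cost $c>0$. For every $\rho\in[0,1]$ there are thresholds $\gamma(q)\in[0,1]$, one for each queueing state $q$, such that the rule $$\tau^*=\inf\{k\ge0:\Pi_k\ge\gamma(Q_k)\}\qquad(\inf\emptyset=\infty)$$ is a stopping time with respect to $(\mathcal I_k)$ and minimizes the Bayesian risk $$P(\tau<T)+c\,\mathsf E[(\tau-T)^+]$$ over all stopping times $\tau$ with respect to $(\mathcal I_k)$ with values in $\{0,1,2,\dots\}\cup\{\infty\}$.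 Moreover, the thresholds $\gamma(q)$ can be chosen independent of $\rho$, except possibly for the initial queueing state $q=Q_0=[m,1,0,\mathbf 0,\mathbf 0]$. -/

import Mathlib

open MeasureTheory ProbabilityTheory
open scoped ENNReal

namespace NADM

/-! ### The queueing network

`N` sensors, sampling period `m` slots (the reciprocal of the sampling rate); batch `b ≥ 1` is
sampled by all sensors at the time instant `b * m`.  The outcome of slot `k` is an element of
`Fin (N + 1)`: `0` means that there is no successful transmission in the slot, `j.succ` means that
node `j : Fin N` successfully transmits the packet at the head of its queue. -/

/-- Configuration of sensor queues, sequencer and decision maker in a slot: `B` is the index of the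
batch being processed, `L i` the queue length at sensor `i` (just after the beginning of the slot),
`W i` the length of the `i`-th sequencing queue, and `R i` tells whether the component `i` of
batch `B` has been received by the decision maker. -/
@[ext] structure NetState (N : ℕ) where
  B : ℕ
  L : Fin N → ℕ
  W : Fin N → ℕ
  R : Fin N → Bool

/-- The network state observed by the decision maker, `Q = [lam, B, Δ, W, R]`. -/
@[ext] structure QueueState (N : ℕ) where
  lam : ℕ
  B : ℕ
  Δ : ℕ
  W : Fin N → ℕ
  R : Fin N → Bool

instance (N : ℕ) : MeasurableSpace (NetState N) := ⊤
instance (N : ℕ) : MeasurableSpace (QueueState N) := ⊤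

/-- Number of slots to go for the next sampling instant, at the beginning of slot `k`. -/
def slotsToGo (m k : ℕ) : ℕ := m - k % m

/-- The component `j` is the only component of the current batch not received so far. -/
def IsLast {N : ℕ} (s : NetState N) (j : Fin N) : Prop :=
  s.R j = false ∧ ∀ i, i ≠ j → s.R i = true

open Classical in
/-- Configuration in slot `k + 1`, given the configuration `s` and the outcome of slot `k`. -/
noncomputable def netStep {N : ℕ} (m k : ℕ) (s : NetState N) (o : Fin (N + 1)) : NetState N where
  B := if ∃ j : Fin N, o = j.succ ∧ IsLast s j then s.B + 1 else s.B
  L := fun i => s.L i - (if o = i.succ then 1 else 0) + (if slotsToGo m (k + 1) = m then 1 else 0)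
  W := fun i =>
    if ∃ j : Fin N, o = j.succ ∧ IsLast s j then s.W i - 1
    else if o = i.succ ∧ s.R i = true then s.W i + 1
    else s.W i
  R := fun i =>
    if ∃ j : Fin N, o = j.succ ∧ IsLast s j then decide (0 < s.W i)
    else if o = i.succ then true
    else s.R i

/-- Configuration in slot `k` when the slot outcomes are `o 0, o 1, …`
(it depends on `o 0, …, o (k - 1)` only). -/
noncomputable def netState {N : ℕ} (m : ℕ) (o : ℕ → Fin (N + 1)) : ℕ → NetState N
  | 0 => { B := 1, L := fun _ => 0, W := fun _ => 0, R := fun _ => false }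
  | k + 1 => netStep m k (netState m o k) (o k)

/-- The network state at time `k`; `Δ = max (k - B * m) 0`. -/
noncomputable def queueState {N : ℕ} (m : ℕ) (o : ℕ → Fin (N + 1)) (k : ℕ) : QueueState N where
  lam := slotsToGo m k
  B := (netState m o k).B
  Δ := k - (netState m o k).B * m
  W := (netState m o k).W
  R := (netState m o k).R

/-- The network state at time `0`. -/
def initialQueueState (N m : ℕ) : QueueState N where
  lam := m
  B := 1
  Δ := 0
  W := fun _ => 0
  R := fun _ => false

/-- Number of nodes contending for the slot. -/
def contenders {N : ℕ} (s : NetState N) : ℕ := (Finset.univ.filter fun i => 0 < s.L i).card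

/-- Probability of the outcome of a slot, given the configuration: if some queue is nonempty, there
is a success with probability `σ`, and it is ascribed uniformly to one of the contending nodes. -/
noncomputable def outcomeProb {N : ℕ} (σ : ℝ) (s : NetState N) (o : Fin (N + 1)) : ℝ :=
  Fin.cases (motive := fun _ => ℝ)
    (if contenders s = 0 then 1 else 1 - σ)
    (fun j => if 0 < s.L j then σ / contenders s else 0) o

open Classical in
/-- Index of the batch whose component `i` is handed to the decision maker as a result of the slot
outcome `o` in configuration `s` (`none` if no sample of node `i` is handed over).  A current sample
is handed over at once; when it completes batch `B`, the head-of-line samples (of batch `B + 1`)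
in the sequencing queues are handed over as well. -/
noncomputable def delivered {N : ℕ} (s : NetState N) (o : Fin (N + 1)) (i : Fin N) : Option ℕ :=
  if o = i.succ ∧ s.R i = false then some s.B
  else if (∃ j : Fin N, o = j.succ ∧ IsLast s j) ∧ 0 < s.W i then some (s.B + 1)
  else none

/-! ### The probabilistic model -/

section Model

variable {Ω 𝒳 : Type*} [MeasurableSpace Ω] [MeasurableSpace 𝒳] {N : ℕ}

/-- `T` is the change time, `M k` the outcome of slot `k`, and `X b i` the sample taken by sensor `i`
in batch `b ≥ 1`.  The change time has the (zero-modified) geometric law with parameters `ρ, p`;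
given the change time the samples are independent with law `F₁` if taken at or after the change
and `F₀` if taken before; the slot outcomes follow the contention model with success rate `σ`
and are independent of the change time and of the samples. -/
structure IsModel (m : ℕ) (σ p ρ : ℝ) (F₀ F₁ : Measure 𝒳) (μ : Measure Ω)
    (T : Ω → ℕ) (M : ℕ → Ω → Fin (N + 1)) (X : ℕ → Fin N → Ω → 𝒳) : Prop where
  measurable_T : Measurable T
  measurable_M : ∀ k, Measurable (M k)
  measurable_X : ∀ b i, Measurable (X b i)
  law_T_zero : μ.real {ω | T ω = 0} = ρ
  law_T_pos : ∀ k, 1 ≤ k → μ.real {ω | T ω = k} = (1 - ρ) * (p * (1 - p) ^ (k - 1))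
  law_M : ∀ (k : ℕ) (o : ℕ → Fin (N + 1)),
    μ.real {ω | ∀ l, l < k + 1 → M l ω = o l} =
      μ.real {ω | ∀ l, l < k → M l ω = o l} * outcomeProb σ (netState m o k) (o k)
  law_X : ∀ (t n : ℕ) (A : ℕ → Fin N → Set 𝒳), (∀ b i, MeasurableSet (A b i)) →
    μ.real {ω | T ω = t ∧ ∀ b ∈ Finset.Icc 1 n, ∀ i, X b i ω ∈ A b i} =
      μ.real {ω | T ω = t} *
        ∏ b ∈ Finset.Icc 1 n, ∏ i, (if t ≤ b * m then F₁ else F₀).real (A b i)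
  indep : IndepFun (fun ω k => M k ω) (fun ω => (T ω, fun (b : ℕ) (i : Fin N) => X (b + 1) i ω)) μ

/-- The network state `Q k` as a random variable. -/
noncomputable def Q (m : ℕ) (M : ℕ → Ω → Fin (N + 1)) (k : ℕ) (ω : Ω) : QueueState N :=
  queueState m (fun l => M l ω) k

/-- The samples received by the decision maker at time `k`; the entry of node `i` is `Sum.inr ()`
if no sample of node `i` is received. -/
noncomputable def Y (m : ℕ) (M : ℕ → Ω → Fin (N + 1)) (X : ℕ → Fin N → Ω → 𝒳) :
    ℕ → Ω → Fin N → 𝒳 ⊕ Unit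
  | 0 => fun _ _ => Sum.inr ()
  | k + 1 => fun ω i =>
      match delivered (netState m (fun l => M l ω) k) (M k ω) i with
      | none => Sum.inr ()
      | some b => Sum.inl (X b i ω)

/-- The observation `Z k = [Q k, Y k]`. -/
noncomputable def Z (m : ℕ) (M : ℕ → Ω → Fin (N + 1)) (X : ℕ → Fin N → Ω → 𝒳) (k : ℕ) (ω : Ω) :
    QueueState N × (Fin N → 𝒳 ⊕ Unit) :=
  (Q m M k ω, Y m M X k ω)

instance : Countable (NetState N) :=
  Function.Injective.countable (f := fun s : NetState N => (s.B, s.L, s.W, s.R)) (by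
    intro s t h
    simp only [Prod.mk.injEq] at h
    exact NetState.ext h.1 h.2.1 h.2.2.1 h.2.2.2)

instance : DiscreteMeasurableSpace (NetState N) := ⟨fun _ => trivial⟩

theorem measurable_netState {m : ℕ} {M : ℕ → Ω → Fin (N + 1)} (hM : ∀ k, Measurable (M k)) (k : ℕ) :
    Measurable (fun ω => netState m (fun l => M l ω) k) := by
  induction k with
  | zero => exact measurable_const
  | succ k ih =>
    exact (measurable_of_countable
      (fun x : NetState N × Fin (N + 1) => netStep m k x.1 x.2)).comp (ih.prodMk (hM k))

theorem measurable_Z {m : ℕ} {M : ℕ → Ω → Fin (N + 1)} {X : ℕ → Fin N → Ω → 𝒳}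
    (hM : ∀ k, Measurable (M k)) (hX : ∀ b i, Measurable (X b i)) (k : ℕ) :
    Measurable (Z m M X k) := by
  refine Measurable.prodMk ?_ ?_
  · exact (measurable_of_countable (fun s : NetState N =>
      (⟨slotsToGo m k, s.B, k - s.B * m, s.W, s.R⟩ : QueueState N))).comp (measurable_netState hM k)
  · cases k with
    | zero => exact measurable_const
    | succ k =>
      refine measurable_pi_lambda _ fun i => ?_
      intro A hA
      have hd : ∀ d : NetState N × Fin (N + 1),
          MeasurableSet {ω | (netState m (fun l => M l ω) k, M k ω) = d} := fun d =>
        ((measurable_netState hM k).prodMk (hM k)) (measurableSet_singleton d)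
      have : (fun ω => Y m M X (k + 1) ω i) ⁻¹' A =
          ⋃ d : NetState N × Fin (N + 1),
            {ω | (netState m (fun l => M l ω) k, M k ω) = d} ∩
            {ω | (match delivered d.1 d.2 i with
              | none => Sum.inr ()
              | some b => Sum.inl (X b i ω) : 𝒳 ⊕ Unit) ∈ A} := by
        ext ω
        simp [Y]
      rw [this]
      refine MeasurableSet.iUnion fun d => (hd d).inter ?_
      cases delivered d.1 d.2 i with
      | none => exact (measurable_const (a := (Sum.inr () : 𝒳 ⊕ Unit))) hA
      | some b => exact (measurable_inl.comp (hX b i)) hA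

/-- The information available to the decision maker: the σ-algebra at time `k` is generated by
the observations `Z 0, …, Z k`. -/
noncomputable def information {m : ℕ} {M : ℕ → Ω → Fin (N + 1)} {X : ℕ → Fin N → Ω → 𝒳}
    (hM : ∀ k, Measurable (M k)) (hX : ∀ b i, Measurable (X b i)) :
    Filtration ℕ (inferInstance : MeasurableSpace Ω) where
  seq k := ⨆ l ≤ k, MeasurableSpace.comap (Z m M X l) inferInstance
  mono' := fun _ _ h => biSup_mono fun _ hl => hl.trans h
  le' := fun _ => iSup₂_le fun l _ => (measurable_Z hM hX l).comap_le

/-- The posterior probability at time `k` that the change has occurred, `P(T ≤ k | ℱ k)`. -/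
noncomputable def posterior (μ : Measure Ω) (T : Ω → ℕ)
    (ℱ : Filtration ℕ (inferInstance : MeasurableSpace Ω))
    (k : ℕ) : Ω → ℝ :=
  μ⟦{ω | T ω ≤ k} | ℱ k⟧

/-- The Bayesian risk `P(τ < T) + c * E[(τ - T)⁺]` of a decision time `τ` (`⊤`: never stop).
The subtraction in `ℕ∞` is truncated at `0`. -/
noncomputable def risk (c : ℝ) (μ : Measure Ω) (T : Ω → ℕ) (τ : Ω → ℕ∞) : ℝ≥0∞ :=
  μ {ω | τ ω < (T ω : ℕ∞)} + ENNReal.ofReal c * ∫⁻ ω, ((τ ω - (T ω : ℕ∞) : ℕ∞) : ℝ≥0∞) ∂μ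

/-- The threshold rule `inf {k ≥ 0 : P k ≥ γ (q k)}` (`⊤` if there is no such `k`). -/
noncomputable def thresholdRule (γ : QueueState N → ℝ) (P : ℕ → Ω → ℝ) (q : ℕ → Ω → QueueState N)
    (ω : Ω) : ℕ∞ :=
  sInf {n : ℕ∞ | ∃ k : ℕ, n = k ∧ γ (q k ω) ≤ P k ω}

end Model

end NADM

namespace NADM

/-! ### Combinatorics of the network -/

section Network

variable {N : ℕ}

/-! Bayes' rule turns the problem into a Markovian stopping problem whose statistical part is
one-dimensional. Let r = min(k, B_k m) be the reference time (`refTime`). Every sample received by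
time k was taken at or before r, so all change times t > r have the same likelihood
(`likelihood_congr`). A sample handed over in slot k was taken at or after r, so all t ≤ r act on it
alike (`Reachable.refTime_le_of_delivered`). Since the geometric law is memoryless, two unnormalized
weights suffice: u for a change up to r, w for a change after r. Their update (`early_succ`,
`late_succ`) does not involve ρ. Stopping in slot k costs (1-p)^Δ w, the weight of T > k; waiting
costs c times the complementary weight.

The threshold structure needs no concavity. Finite-horizon costs are homogeneous of degree one in
(u, w) and nondecreasing in each variable, and the stopping cost does not involve u. If stopping is
no worse than continuing at the fraction x = w/(u+w), then scaling by y/x and raising u gives the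
same at any y < x (`mem_stopSet_of_le`); a Lipschitz bound in u closes the set
(`boundary_mem_stopSet`). So stopping is optimal iff x is at most a boundary depending on slot and
configuration (`stopOptimal_iff`), and the posterior 1 - (1-p)^Δ x is decreasing in x.

The boundary depends on the slot and on the unobserved queue lengths. Counting samples shows that
the observed state determines both (`Reachable.eq_of_observedState`), except for the initial state,
which can appear at times 0 and m. Nothing has been received by time m, so the posterior is
deterministic at both times, and one value depending on ρ serves both.

For optimality, the likelihood is the density of the observed history
(`measure_changeTime_inter_observe`), this history generates the information
(`information_eq_comap_observe`), and the risk is a sum of slot costs (`risk_eq_tsum`). Any policy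
pays at least the horizon-n optimum minus P(T > n), which tends to 0 (`lintegral_value_le_risk`); a
policy following the optimal stopping sets pays at most the infimum of these optima
(`risk_le_lintegral_value`). -/

theorem slotsToGo_eq_iff {m k : ℕ} (hm : 1 ≤ m) : slotsToGo m k = m ↔ k % m = 0 := by
  have := Nat.mod_lt k hm
  unfold slotsToGo
  omega

/-- Invariants of the configurations which can be attained in slot `k`. -/
structure Reachable (m k : ℕ) (s : NetState N) : Prop where
  B_pos : 1 ≤ s.B
  count : ∀ i, s.B + (if s.R i = true then 1 else 0) + s.W i + s.L i = k / m + 1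
  W_zero : ∀ i, s.R i = false → s.W i = 0
  L_pos : ∀ i, k % m = 0 → 1 ≤ k → 1 ≤ s.L i

theorem reachable_zero (m : ℕ) (o : ℕ → Fin (N + 1)) : Reachable m 0 (netState m o 0) where
  B_pos := le_rfl
  count i := by simp [netState]
  W_zero i _ := rfl
  L_pos i _ h := by omega

theorem IsLast.unique {s : NetState N} {i j : Fin N} (hi : IsLast s i) (hj : IsLast s j) :
    i = j := by
  by_contra h
  have := hj.2 i h
  rw [hi.1] at this
  exact absurd this (by decide)

/-- Samples are conserved: each one of sensor i is in a completed batch, in the current batch, in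
the sequencer or in the queue. When a batch is completed, the increment of `B` accounts for the
reset of `R` and the removal of the head of each sequencing queue. The hypothesis `ho` keeps the
truncated subtraction in `L` exact. -/
theorem Reachable.netStep {m k : ℕ} (hm : 1 ≤ m) {s : NetState N} (hs : Reachable m k s)
    {o : Fin (N + 1)} (ho : ∀ i : Fin N, o = i.succ → 0 < s.L i) :
    Reachable m (k + 1) (netStep m k s o) := by
  have hdiv : (k + 1) / m = k / m + if (k + 1) % m = 0 then 1 else 0 := by
    rw [Nat.succ_div]
    simp only [Nat.dvd_iff_mod_eq_zero]
  have hgo := slotsToGo_eq_iff (m := m) (k := k + 1) hm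
  refine ⟨?_, fun i => ?_, fun i => ?_, fun i h0 _ => ?_⟩
  · have := hs.B_pos
    simp only [NADM.netStep]
    split_ifs <;> omega
  · have hc := hs.count i
    have hw := hs.W_zero i
    have hoi := ho i
    rw [hdiv]
    simp only [NADM.netStep, hgo]
    by_cases hl : ∃ j : Fin N, o = j.succ ∧ IsLast s j
    · obtain ⟨j, rfl, hj⟩ := hl
      have hex : ∃ j' : Fin N, j.succ = j'.succ ∧ IsLast s j' := ⟨j, rfl, hj⟩
      simp only [if_pos hex, Fin.succ_inj, decide_eq_true_eq]
      by_cases hij : j = i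
      · subst hij
        have h1 := hw hj.1
        have h2 := hoi rfl
        rw [hj.1] at hc
        simp only [h1] at hc ⊢
        simp at hc ⊢
        omega
      · have hR := hj.2 i (Ne.symm hij)
        rw [hR] at hc
        simp only [if_neg hij] at hc ⊢
        simp at hc
        split_ifs <;> omega
    · simp only [if_neg hl]
      by_cases hi : o = i.succ
      · have h2 := hoi hi
        simp only [hi, true_and, if_true] at hc ⊢
        cases hR : s.R i
        · simp [hR] at hc ⊢
          omega
        · simp [hR] at hc ⊢
          omega
      · simp only [hi, false_and, if_false] at hc ⊢
        omega
  · have hw := hs.W_zero i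
    simp only [NADM.netStep]
    by_cases hl : ∃ j : Fin N, o = j.succ ∧ IsLast s j
    · simp only [if_pos hl, decide_eq_false_iff_not]
      omega
    · simp only [if_neg hl]
      by_cases hi : o = i.succ
      · simp [hi]
      · simp only [hi, false_and, if_false]
        exact hw
  · simp only [NADM.netStep]
    rw [if_pos (hgo.2 h0)]
    omega

/-- The network state displayed by a configuration in slot `k`. -/
def observedState (m k : ℕ) (s : NetState N) : QueueState N :=
  ⟨slotsToGo m k, s.B, k - s.B * m, s.W, s.R⟩

theorem Reachable.le_of_queued {m k : ℕ} {s : NetState N} (hs : Reachable m k s) {i : Fin N}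
    (h : 0 < s.L i) : s.B * m ≤ k := by
  have := hs.count i
  exact (Nat.mul_le_mul_right m (by omega : s.B ≤ k / m)).trans (Nat.div_mul_le_self k m)

theorem Reachable.le_of_sequenced {m k : ℕ} {s : NetState N} (hs : Reachable m k s) {i : Fin N}
    (h : 0 < s.W i) : (s.B + 1) * m ≤ k := by
  have h1 := hs.count i
  have h2 := hs.W_zero i
  have h3 : s.R i = true := by
    by_contra h4
    have := h2 (by simpa using h4)
    omega
  rw [if_pos h3] at h1
  exact (Nat.mul_le_mul_right m (by omega : s.B + 1 ≤ k / m)).trans (Nat.div_mul_le_self k m)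

/-- All batches before the current one are complete, hence already sampled. -/
theorem Reachable.pred_batch_le {m k : ℕ} (hN : 1 ≤ N) {s : NetState N} (hs : Reachable m k s) :
    (s.B - 1) * m ≤ k := by
  have h1 := hs.count ⟨0, hN⟩
  have h2 : s.B - 1 ≤ k / m := by
    generalize k / m = d at h1 ⊢
    omega
  exact (Nat.mul_le_mul_right m h2).trans (Nat.div_mul_le_self k m)

/-- Two slots with the same state are congruent modulo `m`, and if they differ then both precede or
equal the sampling time of batch `B`. As batch `B - 1` is complete, the earlier slot is its sampling
instant, where its samples have only just been queued. This is impossible unless that slot is 0. -/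
theorem Reachable.eq_or_eq_of_observedState {m k k' : ℕ} (hN : 1 ≤ N) (hm : 1 ≤ m)
    {s s' : NetState N} (hs : Reachable m k s) (hkk : k ≤ k')
    (h : observedState m k s = observedState m k' s') :
    k = k' ∨ observedState m k s = initialQueueState N m := by
  by_contra hcon
  push Not at hcon
  obtain ⟨hne, hini⟩ := hcon
  simp only [observedState, QueueState.mk.injEq] at h
  obtain ⟨h1, hB, hΔ, hW, hR⟩ := h
  have hmod : k % m = k' % m := by
    have a := Nat.mod_lt k hm
    have b := Nat.mod_lt k' hm
    unfold slotsToGo at h1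
    omega
  rw [← hB] at hΔ
  -- `Δ` is strictly increasing in the slot once it is positive, so equal values at different slots
  -- are both 0.
  have hk' : k' ≤ s.B * m := by omega
  have hp := hs.pred_batch_le hN
  have e1 := Nat.div_add_mod k m
  have e2 := Nat.div_add_mod k' m
  have hq : k / m < k' / m := by
    by_contra hq
    have : k' / m ≤ k / m := by omega
    have := Nat.mul_le_mul_left m this
    omega
  have hq2 : k' / m ≤ s.B := by
    have := Nat.div_le_div_right (c := m) hk'
    rwa [Nat.mul_div_cancel _ hm] at this
  have c0 := hs.count ⟨0, hN⟩
  have hk0 : k / m + 1 = s.B := by omega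
  have hq3 : k' / m = s.B := by omega
  rw [hq3] at e2
  have hmul : m * s.B = s.B * m := mul_comm _ _
  have hkm : k % m = 0 := by omega
  have hall : ∀ i, s.R i = false ∧ s.W i = 0 ∧ s.L i = 0 := fun i => by
    have := hs.count i
    have hr : ¬ s.R i = true := by
      intro h
      rw [if_pos h] at this
      omega
    rw [if_neg hr] at this
    exact ⟨by simpa using hr, by omega, by omega⟩
  -- At a positive sampling instant the sample just taken is still queued, against the empty queues
  -- in `hall`.
  have hk1 : k = 0 := by
    by_contra h0
    have := hs.L_pos ⟨0, hN⟩ hkm (by omega)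
    have := (hall ⟨0, hN⟩).2.2
    omega
  apply hini
  have hB1 : s.B = 1 := by
    rw [hk1] at hk0
    simpa using hk0.symm
  simp only [observedState, initialQueueState, QueueState.mk.injEq]
  refine ⟨(slotsToGo_eq_iff hm).2 hkm, hB1, ?_, funext fun i => (hall i).2.1,
    funext fun i => (hall i).1⟩
  simp [hk1]

/-- The hidden queue lengths are recovered from the sample count. -/
theorem Reachable.eq_of_observedState_same {m k : ℕ}
    {s s' : NetState N} (hs : Reachable m k s) (hs' : Reachable m k s')
    (h : observedState m k s = observedState m k s') : s = s' := by
  simp only [observedState, QueueState.mk.injEq] at h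
  obtain ⟨-, hB, -, hW, hR⟩ := h
  refine NetState.ext hB (funext fun i => ?_) hW hR
  have h1 := hs.count i
  have h2 := hs'.count i
  rw [← hB, ← hW, ← hR] at h2
  omega

/-- Except for the initial one, a network state determines the slot and the configuration. -/
theorem Reachable.eq_of_observedState {m k k' : ℕ} (hN : 1 ≤ N) (hm : 1 ≤ m)
    {s s' : NetState N} (hs : Reachable m k s) (hs' : Reachable m k' s')
    (h : observedState m k s = observedState m k' s')
    (hini : observedState m k s ≠ initialQueueState N m) : k = k' ∧ s = s' := by
  have hk : k = k' := by
    rcases le_total k k' with hkk | hkk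
    · exact (hs.eq_or_eq_of_observedState hN hm hkk h).resolve_right hini
    · exact ((hs'.eq_or_eq_of_observedState hN hm hkk h.symm).resolve_right (h ▸ hini)).symm
  subst hk
  exact ⟨rfl, hs.eq_of_observedState_same hs' h⟩

/-- The initial state has `B = 1` and `Δ = 0`, so k ≤ m, and its first component makes k a multiple
of m. -/
theorem eq_zero_or_eq_of_observedState_initial {m k : ℕ} (hm : 1 ≤ m) {s : NetState N}
    (h : observedState m k s = initialQueueState N m) : k = 0 ∨ k = m := by
  simp only [observedState, initialQueueState, QueueState.mk.injEq] at h
  obtain ⟨h1, hB, hΔ, -, -⟩ := h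
  rw [hB, one_mul] at hΔ
  have h0 := (slotsToGo_eq_iff hm).1 h1
  have := Nat.le_of_dvd (n := m) (m := k)
  by_cases hk : k = 0
  · exact Or.inl hk
  · have := Nat.le_of_dvd (by omega) (Nat.dvd_of_mod_eq_zero h0)
    exact Or.inr (by omega)

/-- The configuration at the first sampling instant. -/
def firstSamplingState (N : ℕ) : NetState N := ⟨1, fun _ => 1, fun _ => 0, fun _ => false⟩

theorem Reachable.eq_firstSamplingState {m : ℕ} (hN : 1 ≤ N) (hm : 1 ≤ m) {s : NetState N}
    (hs : Reachable m m s) : s = firstSamplingState N := by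
  have hB := hs.B_pos
  have hd : m / m = 1 := Nat.div_self hm
  have key : ∀ i, s.B = 1 ∧ s.L i = 1 ∧ s.W i = 0 ∧ s.R i = false := fun i => by
    have h1 := hs.count i
    have h2 := hs.L_pos i (Nat.mod_self m) hm
    rw [hd] at h1
    cases hR : s.R i
    · simp [hR] at h1
      exact ⟨by omega, by omega, by omega, rfl⟩
    · simp [hR] at h1
      omega
  exact NetState.ext (key ⟨0, hN⟩).1 (funext fun i => (key i).2.1) (funext fun i => (key i).2.2.1)
    (funext fun i => (key i).2.2.2)

/-- The observable part of the next configuration reveals the outcome of the slot. -/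
theorem netStep_observable_injective {m k : ℕ} {s : NetState N} {o o' : Fin (N + 1)}
    (hB : (netStep m k s o).B = (netStep m k s o').B)
    (hW : (netStep m k s o).W = (netStep m k s o').W)
    (hR : (netStep m k s o).R = (netStep m k s o').R) : o = o' := by
  by_cases hl : ∃ j : Fin N, o = j.succ ∧ IsLast s j
  · by_cases hl' : ∃ j : Fin N, o' = j.succ ∧ IsLast s j
    · obtain ⟨j, rfl, hj⟩ := hl
      obtain ⟨j', rfl, hj'⟩ := hl'
      rw [hj.unique hj']
    · simp only [netStep, if_pos hl, if_neg hl'] at hB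
      omega
  · by_cases hl' : ∃ j : Fin N, o' = j.succ ∧ IsLast s j
    · simp only [netStep, if_pos hl', if_neg hl] at hB
      omega
    · simp only [netStep, if_neg hl', if_neg hl] at hW hR
      -- A transmission by node `j` that completes no batch is visible: either it sets `R j`, or `R
      -- j` was already set and `W j` grows.
      have aux : ∀ {a b : Fin (N + 1)},
          (∀ i, (if a = i.succ ∧ s.R i = true then s.W i + 1 else s.W i) =
            (if b = i.succ ∧ s.R i = true then s.W i + 1 else s.W i)) →
          (∀ i, (if a = i.succ then true else s.R i) = (if b = i.succ then true else s.R i)) →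
          ∀ j : Fin N, a = j.succ → b = j.succ := by
        intro a b h1 h2 j hj
        by_contra hb
        have h1 := h1 j
        have h2 := h2 j
        simp only [hj, hb, true_and, false_and, if_true, if_false] at h1 h2
        rw [if_pos h2.symm] at h1
        omega
      have h1 := aux (a := o) (b := o') (fun i => congrFun hW i) (fun i => congrFun hR i)
      have h2 := aux (a := o') (b := o) (fun i => (congrFun hW i).symm)
        (fun i => (congrFun hR i).symm)
      induction o using Fin.cases with
      | zero =>
        induction o' using Fin.cases with
        | zero => rfl
        | succ j => exact h2 j rfl
      | succ j => exact (h1 j rfl).symm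

/-! ### Samples handed over -/

/-- The sample of node `i` in batch `b` has been received by the decision maker. -/
def Received (s : NetState N) (b : ℕ) (i : Fin N) : Prop :=
  1 ≤ b ∧ (b < s.B ∨ (b = s.B ∧ s.R i = true))

theorem Received.netStep {m k : ℕ} {s : NetState N} {b : ℕ} {i : Fin N} (h : Received s b i)
    (o : Fin (N + 1)) : Received (netStep m k s o) b i := by
  obtain ⟨h0, h⟩ := h
  refine ⟨h0, ?_⟩
  by_cases hl : ∃ j : Fin N, o = j.succ ∧ IsLast s j
  · simp only [NADM.netStep, if_pos hl]
    rcases h with h | h <;> left <;> omega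
  · simp only [NADM.netStep, if_neg hl]
    rcases h with h | h
    · exact Or.inl h
    · right
      refine ⟨h.1, ?_⟩
      split_ifs
      · rfl
      · exact h.2

theorem delivered_eq_some_iff {s : NetState N} {o : Fin (N + 1)} {i : Fin N} {b : ℕ} :
    delivered s o i = some b ↔ (o = i.succ ∧ s.R i = false ∧ b = s.B) ∨
      (¬ (o = i.succ ∧ s.R i = false) ∧ (∃ j : Fin N, o = j.succ ∧ IsLast s j) ∧ 0 < s.W i ∧
        b = s.B + 1) := by
  unfold delivered
  split_ifs with h1 h2
  · simp only [Option.some.injEq]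
    grind
  · simp only [Option.some.injEq]
    grind
  · grind

/-- No sample is handed over twice; this is what makes the constraints of different slots concern
different samples. -/
theorem not_received_of_delivered {s : NetState N} {o : Fin (N + 1)} {i : Fin N} {b : ℕ}
    (h : delivered s o i = some b) : ¬ Received s b i := by
  rw [delivered_eq_some_iff] at h
  rintro ⟨-, hr⟩
  rcases h with ⟨-, h, rfl⟩ | ⟨-, -, -, rfl⟩
  · simp [h] at hr
  · omega

theorem received_of_delivered {m k : ℕ} {s : NetState N} {o : Fin (N + 1)} {i : Fin N} {b : ℕ}
    (hB : 1 ≤ s.B) (h : delivered s o i = some b) : Received (netStep m k s o) b i := by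
  rw [delivered_eq_some_iff] at h
  rcases h with ⟨ho, hR, rfl⟩ | ⟨-, hl, hW, rfl⟩
  · refine ⟨hB, ?_⟩
    by_cases hl : ∃ j : Fin N, o = j.succ ∧ IsLast s j
    · left
      simp only [NADM.netStep, if_pos hl]
      omega
    · right
      simp only [NADM.netStep, if_neg hl, if_pos ho, and_self]
  · refine ⟨by omega, Or.inr ?_⟩
    simp only [NADM.netStep, if_pos hl, hW, decide_true, and_self]

theorem netState_B_pos (m : ℕ) (o : ℕ → Fin (N + 1)) (k : ℕ) : 1 ≤ (netState m o k).B := by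
  induction k with
  | zero => exact le_rfl
  | succ k ih =>
    simp only [netState, netStep]
    split_ifs <;> omega

theorem netState_congr {m k : ℕ} {o o' : ℕ → Fin (N + 1)} (h : ∀ l < k, o l = o' l) :
    netState m o k = netState m o' k := by
  induction k with
  | zero => rfl
  | succ k ih =>
    simp only [netState]
    rw [ih fun l hl => h l (by omega), h k (by omega)]

/-- The last slot before which the change can affect the samples received so far: with reference
to the change, only the samples taken up to this time matter. -/
def refTime (m k : ℕ) (s : NetState N) : ℕ := min k (s.B * m)

theorem refTime_le_netStep (m k : ℕ) (s : NetState N) (o : Fin (N + 1)) :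
    refTime m k s ≤ refTime m (k + 1) (netStep m k s o) := by
  have : s.B ≤ (netStep m k s o).B := by
    simp only [netStep]
    split_ifs <;> omega
  have := Nat.mul_le_mul_right m this
  unfold refTime
  omega

/-- A possible slot outcome: only nodes with a nonempty queue transmit. -/
def Possible (s : NetState N) (o : Fin (N + 1)) : Prop := ∀ i : Fin N, o = i.succ → 0 < s.L i

/-- A sample of the current batch was taken at `B * m`, which is then the old reference time. A
sequenced sample belongs to batch `B + 1` and moves the reference time to its own sampling time.
Consequently the law of a handed-over sample is constant for the change time in each of t ≤ r, r < t
≤ r' and t > r', where r and r' are the old and new reference times. -/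
theorem Reachable.refTime_le_of_delivered {m k : ℕ} {s : NetState N}
    (hs : Reachable m k s) {o : Fin (N + 1)} (ho : Possible s o) {i : Fin N} {b : ℕ}
    (h : delivered s o i = some b) : refTime m k s ≤ b * m ∧
      b * m ≤ refTime m (k + 1) (NADM.netStep m k s o) ∧
      (b * m ≤ refTime m k s ∨ refTime m (k + 1) (NADM.netStep m k s o) = b * m) := by
  rw [delivered_eq_some_iff] at h
  rcases h with ⟨ho', hR, rfl⟩ | ⟨-, hl, hW, rfl⟩
  · have h1 := hs.le_of_queued (ho i ho')
    have h2 := refTime_le_netStep m k s o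
    have : refTime m k s = s.B * m := by
      unfold refTime
      omega
    omega
  · have h1 := hs.le_of_sequenced hW
    have h2 : (NADM.netStep m k s o).B = s.B + 1 := by simp only [NADM.netStep, if_pos hl]
    have h3 : refTime m (k + 1) (NADM.netStep m k s o) = (s.B + 1) * m := by
      unfold refTime
      rw [h2]
      omega
    have h4 := refTime_le_netStep m k s o
    omega

/-- The first batch is sampled at time `m`, so there is nothing to transmit earlier. -/
theorem Reachable.delivered_eq_none {m k : ℕ} {s : NetState N}
    (hs : Reachable m k s) (hk : k < m) {o : Fin (N + 1)} (ho : Possible s o) (i : Fin N) :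
    delivered s o i = none := by
  rw [Option.eq_none_iff_forall_ne_some]
  intro b hb
  have h1 : 1 ≤ s.B := hs.B_pos
  rw [delivered_eq_some_iff] at hb
  rcases hb with ⟨ho', -, -⟩ | ⟨-, -, hW, -⟩
  · have := hs.le_of_queued (ho i ho')
    have := Nat.mul_le_mul_right m h1
    omega
  · have := hs.le_of_sequenced hW
    have := Nat.mul_le_mul_right m (show 1 ≤ s.B + 1 by omega)
    omega

/-! ### Outcome probabilities -/

theorem outcomeProb_nonneg {σ : ℝ} (hσ0 : 0 ≤ σ) (hσ1 : σ ≤ 1) (s : NetState N) (o : Fin (N + 1)) :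
    0 ≤ outcomeProb σ s o := by
  induction o using Fin.cases with
  | zero =>
    simp only [outcomeProb, Fin.cases_zero]
    split_ifs <;> linarith
  | succ j =>
    simp only [outcomeProb, Fin.cases_succ]
    split_ifs <;> positivity

theorem sum_outcomeProb (σ : ℝ) (s : NetState N) : ∑ o, outcomeProb σ s o = 1 := by
  rw [Fin.sum_univ_succ]
  simp only [outcomeProb, Fin.cases_zero, Fin.cases_succ]
  rw [← Finset.sum_filter, Finset.sum_const, ← contenders]
  split_ifs with h
  · simp [h]
  · have : (contenders s : ℝ) ≠ 0 := by exact_mod_cast h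
    rw [nsmul_eq_mul]
    field_simp
    ring

theorem possible_of_outcomeProb_ne_zero {σ : ℝ} {s : NetState N} {o : Fin (N + 1)}
    (h : outcomeProb σ s o ≠ 0) : Possible s o := by
  rintro i rfl
  by_contra h0
  exact h (by simp only [outcomeProb, Fin.cases_succ, if_neg h0])

end Network

end NADM

namespace NADM

/-! ### Sample densities -/

/-- The parameters of the problem. -/
structure Setting (𝒳 : Type*) [MeasurableSpace 𝒳] where
  m : ℕ
  σ : ℝ
  p : ℝ
  c : ℝ
  F₀ : Measure 𝒳
  F₁ : Measure 𝒳
  one_le_m : 1 ≤ m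
  σ_pos : 0 < σ
  σ_lt_one : σ < 1
  p_pos : 0 < p
  p_lt_one : p < 1
  c_pos : 0 < c
  isProb₀ : IsProbabilityMeasure F₀
  isProb₁ : IsProbabilityMeasure F₁

namespace Setting

variable {𝒳 : Type*} [MeasurableSpace 𝒳] (S : Setting 𝒳) {N : ℕ}

instance : IsProbabilityMeasure S.F₀ := S.isProb₀
instance : IsProbabilityMeasure S.F₁ := S.isProb₁

/-- A probability measure which dominates both sample laws. -/
noncomputable def baseLaw : Measure 𝒳 := (2 : ℝ≥0∞)⁻¹ • (S.F₀ + S.F₁)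

instance : IsProbabilityMeasure S.baseLaw where
  measure_univ := by
    simp only [baseLaw, Measure.smul_apply, Measure.add_apply, measure_univ, smul_eq_mul]
    rw [one_add_one_eq_two]
    exact ENNReal.inv_mul_cancel (by simp) (by simp)

/-- The law of the samples of batch `b` when the change occurs at time `t`. -/
noncomputable def sampleLaw (t b : ℕ) : Measure 𝒳 := if t ≤ b * S.m then S.F₁ else S.F₀

instance (t b : ℕ) : IsProbabilityMeasure (S.sampleLaw t b) := by
  unfold sampleLaw
  split_ifs <;> infer_instance

theorem sampleLaw_absolutelyContinuous (t b : ℕ) : S.sampleLaw t b ≪ S.baseLaw := by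
  refine Measure.AbsolutelyContinuous.smul_right ?_ (by simp)
  unfold sampleLaw
  split_ifs
  · exact Measure.AbsolutelyContinuous.rfl.add_right' S.F₀
  · exact Measure.AbsolutelyContinuous.rfl.add_right S.F₁

/-- Density of the samples of batch `b` when the change occurs at time `t`. -/
noncomputable def sampleDensity (t b : ℕ) : 𝒳 → ℝ≥0∞ := (S.sampleLaw t b).rnDeriv S.baseLaw

theorem sampleDensity_congr {t t' b : ℕ} (h : t ≤ b * S.m ↔ t' ≤ b * S.m) :
    S.sampleDensity t b = S.sampleDensity t' b := by
  unfold sampleDensity sampleLaw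
  simp only [h]

/-- Reference law of an entry of the observation, which contains a sample of the batch `b` for
`some b`, and nothing for `none`. -/
noncomputable def entryLaw : Option ℕ → Measure (𝒳 ⊕ Unit)
  | none => Measure.dirac (Sum.inr ())
  | some _ => S.baseLaw.map Sum.inl

instance (d : Option ℕ) : IsProbabilityMeasure (S.entryLaw d) := by
  cases d with
  | none => exact Measure.dirac.isProbabilityMeasure
  | some b => exact Measure.isProbabilityMeasure_map measurable_inl.aemeasurable

/-- Density of an entry of the observation when the change occurs at time `t`. -/
noncomputable def entryDensity (t : ℕ) : Option ℕ → 𝒳 ⊕ Unit → ℝ≥0∞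
  | none => fun _ => 1
  -- The value on `Sum.inr` is immaterial, since the reference law of such an entry gives it mass
  -- zero.
  | some b => Sum.elim (S.sampleDensity t b) fun _ => 1

theorem measurable_entryDensity (t : ℕ) (d : Option ℕ) : Measurable (S.entryDensity t d) := by
  cases d with
  | none => exact measurable_const
  | some b => exact (Measure.measurable_rnDeriv _ _).sumElim measurable_const

open Classical in
/-- Law of an entry of the observation when the change occurs at time `t`. -/
noncomputable def entryProb (t : ℕ) : Option ℕ → Set (𝒳 ⊕ Unit) → ℝ≥0∞
  | none => fun C => if Sum.inr () ∈ C then 1 else 0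
  | some b => fun C => S.sampleLaw t b (Sum.inl ⁻¹' C)

theorem setLIntegral_entryDensity (t : ℕ) (d : Option ℕ) {C : Set (𝒳 ⊕ Unit)}
    (hC : MeasurableSet C) :
    ∫⁻ x in C, S.entryDensity t d x ∂S.entryLaw d = S.entryProb t d C := by
  classical
  cases d with
  | none =>
    simp only [entryDensity, entryLaw, entryProb, lintegral_const, one_mul,
      Measure.restrict_apply MeasurableSet.univ, Set.univ_inter, Measure.dirac_apply' _ hC,
      Set.indicator_apply, Pi.one_apply]
  | some b =>
    rw [entryLaw, setLIntegral_map hC (S.measurable_entryDensity t (some b)) measurable_inl]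
    exact Measure.setLIntegral_rnDeriv (S.sampleLaw_absolutelyContinuous t b) _

/-- Reference law of the samples handed over as a result of the slot outcome `o`. -/
noncomputable def deliveryLaw (s : NetState N) (o : Fin (N + 1)) : Measure (Fin N → 𝒳 ⊕ Unit) :=
  Measure.pi fun i => S.entryLaw (delivered s o i)

instance (s : NetState N) (o : Fin (N + 1)) : IsProbabilityMeasure (S.deliveryLaw s o) := by
  unfold deliveryLaw
  infer_instance

/-- Density of the samples handed over when the change occurs at time `t`. -/
noncomputable def deliveryDensity (t : ℕ) (s : NetState N) (o : Fin (N + 1))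
    (y : Fin N → 𝒳 ⊕ Unit) : ℝ≥0∞ :=
  ∏ i, S.entryDensity t (delivered s o i) (y i)

theorem measurable_deliveryDensity (t : ℕ) (s : NetState N) (o : Fin (N + 1)) :
    Measurable (S.deliveryDensity t s o) :=
  Finset.measurable_fun_prod _ fun i _ =>
    (S.measurable_entryDensity t _).comp (measurable_pi_apply i)

/-- Under the product reference law the entries are independent, and both the density and the
indicator of the box factor over the nodes. -/
theorem setLIntegral_deliveryDensity (t : ℕ) (s : NetState N) (o : Fin (N + 1))
    {C : Fin N → Set (𝒳 ⊕ Unit)} (hC : ∀ i, MeasurableSet (C i)) :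
    ∫⁻ y in Set.pi Set.univ C, S.deliveryDensity t s o y ∂S.deliveryLaw s o =
      ∏ i, S.entryProb t (delivered s o i) (C i) := by
  classical
  rw [← lintegral_indicator (MeasurableSet.univ_pi hC)]
  have hmeas : ∀ i, Measurable ((C i).indicator (S.entryDensity t (delivered s o i))) := fun i =>
    (S.measurable_entryDensity t _).indicator (hC i)
  have heq : (Set.pi Set.univ C).indicator (S.deliveryDensity t s o) =
      fun y => ∏ i, (C i).indicator (S.entryDensity t (delivered s o i)) (y i) := by
    funext y
    by_cases hy : y ∈ Set.pi Set.univ C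
    · rw [Set.indicator_of_mem hy]
      refine Finset.prod_congr rfl fun i _ => ?_
      rw [Set.indicator_of_mem (hy i (Set.mem_univ i))]
    · rw [Set.indicator_of_notMem hy]
      simp only [Set.mem_univ_pi, not_forall] at hy
      obtain ⟨i, hi⟩ := hy
      exact (Finset.prod_eq_zero (Finset.mem_univ i) (Set.indicator_of_notMem hi _)).symm
  rw [heq, deliveryLaw]
  have hind := iIndepFun_pi (μ := fun i => S.entryLaw (delivered s o i))
    (X := fun i => (C i).indicator (S.entryDensity t (delivered s o i)))
    fun i => (hmeas i).aemeasurable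
  rw [lintegral_prod_eq_prod_lintegral_of_indepFun Finset.univ _ hind
    fun i => (hmeas i).comp (measurable_pi_apply i)]
  refine Finset.prod_congr rfl fun i _ => ?_
  rw [← S.setLIntegral_entryDensity t _ (hC i), ← lintegral_indicator (hC i)]
  exact (measurePreserving_eval (fun i => S.entryLaw (delivered s o i)) i).lintegral_comp (hmeas i)

theorem lintegral_deliveryDensity (t : ℕ) (s : NetState N) (o : Fin (N + 1)) :
    ∫⁻ y, S.deliveryDensity t s o y ∂S.deliveryLaw s o = 1 := by
  have h := S.setLIntegral_deliveryDensity t s o (C := fun _ => Set.univ)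
    fun _ => MeasurableSet.univ
  rw [Set.pi_univ, setLIntegral_univ] at h
  rw [h]
  refine Finset.prod_eq_one fun i _ => ?_
  cases delivered s o i with
  | none => simp [entryProb]
  | some b => simp [entryProb]

theorem deliveryDensity_congr {t t' : ℕ} {s : NetState N} {o : Fin (N + 1)}
    (h : ∀ i b, delivered s o i = some b → (t ≤ b * S.m ↔ t' ≤ b * S.m)) :
    S.deliveryDensity t s o = S.deliveryDensity t' s o := by
  funext y
  refine Finset.prod_congr rfl fun i _ => ?_
  cases hd : delivered s o i with
  | none => rfl
  | some b => simp only [entryDensity, S.sampleDensity_congr (h i b hd)]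

/-! ### Dynamic programming -/

/-- Probability of a slot outcome. -/
noncomputable def outcomeWeight (s : NetState N) (o : Fin (N + 1)) : ℝ≥0∞ :=
  ENNReal.ofReal (outcomeProb S.σ s o)

theorem sum_outcomeWeight (s : NetState N) : ∑ o, S.outcomeWeight s o = 1 := by
  unfold outcomeWeight
  rw [← ENNReal.ofReal_sum_of_nonneg
    fun o _ => outcomeProb_nonneg S.σ_pos.le S.σ_lt_one.le s o, sum_outcomeProb, ENNReal.ofReal_one]

theorem possible_of_outcomeWeight_ne_zero {s : NetState N} {o : Fin (N + 1)}
    (h : S.outcomeWeight s o ≠ 0) : Possible s o := by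
  refine possible_of_outcomeProb_ne_zero (σ := S.σ) fun h0 => h ?_
  rw [outcomeWeight, h0, ENNReal.ofReal_zero]

/-- Probability that the change does not occur in `j` given time slots, if not earlier. -/
noncomputable def survival (j : ℕ) : ℝ≥0∞ := ENNReal.ofReal ((1 - S.p) ^ j)

/-- Probability that the change occurs in one of `j` given time slots, if not earlier. -/
noncomputable def onset (j : ℕ) : ℝ≥0∞ := ENNReal.ofReal (1 - (1 - S.p) ^ j)

theorem pow_nonneg_p (j : ℕ) : 0 ≤ (1 - S.p) ^ j := pow_nonneg (by linarith [S.p_lt_one]) j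

theorem pow_pos_p (j : ℕ) : 0 < (1 - S.p) ^ j := pow_pos (by linarith [S.p_lt_one]) j

theorem pow_le_one_p (j : ℕ) : (1 - S.p) ^ j ≤ 1 :=
  pow_le_one₀ (by linarith [S.p_lt_one]) (by linarith [S.p_pos])

theorem survival_add_onset (j : ℕ) : S.survival j + S.onset j = 1 := by
  unfold survival onset
  rw [← ENNReal.ofReal_add (S.pow_nonneg_p j) (by linarith [S.pow_le_one_p j])]
  simp

/-- Stopping cost in terms of the weight `w` of a change after the reference time. -/
noncomputable def stopCost (k : ℕ) (s : NetState N) (w : ℝ≥0∞) : ℝ≥0∞ :=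
  -- With truncated subtraction, `k - s.B * S.m` is the time elapsed since the reference time.
  S.survival (k - s.B * S.m) * w

/-- Weight of a change up to time `k`. -/
noncomputable def changedWeight (k : ℕ) (s : NetState N) (u w : ℝ≥0∞) : ℝ≥0∞ :=
  u + S.onset (k - s.B * S.m) * w

/-- Update of the weight of a change after the reference time. -/
noncomputable def nextLate (k : ℕ) (s : NetState N) (o : Fin (N + 1)) (y : Fin N → 𝒳 ⊕ Unit)
    (w : ℝ≥0∞) : ℝ≥0∞ :=
  S.survival (refTime S.m (k + 1) (netStep S.m k s o) - refTime S.m k s) * w *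
    -- The new reference time plus one stands for every later change time.
    S.deliveryDensity (refTime S.m (k + 1) (netStep S.m k s o) + 1) s o y

/-- Update of the weight of a change up to the reference time. -/
noncomputable def nextEarly (k : ℕ) (s : NetState N) (o : Fin (N + 1)) (y : Fin N → 𝒳 ⊕ Unit)
    (u w : ℝ≥0∞) : ℝ≥0∞ :=
  -- The old reference time stands for all change times up to it, and the new one for those between
  -- the two.
  u * S.deliveryDensity (refTime S.m k s) s o y +
    S.onset (refTime S.m (k + 1) (netStep S.m k s o) - refTime S.m k s) * w *
      S.deliveryDensity (refTime S.m (k + 1) (netStep S.m k s o)) s o y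

/-- Expectation of the cost `V` in the next slot. -/
noncomputable def expectNext (V : ℕ → NetState N → ℝ≥0∞ → ℝ≥0∞ → ℝ≥0∞)
    (k : ℕ) (s : NetState N) (u w : ℝ≥0∞) : ℝ≥0∞ :=
  ∑ o, S.outcomeWeight s o * ∫⁻ y, V (k + 1) (netStep S.m k s o) (S.nextEarly k s o y u w)
    (S.nextLate k s o y w) ∂S.deliveryLaw s o

/-- Minimal cost of stopping within `n` slots. -/
noncomputable def valueIter : ℕ → ℕ → NetState N → ℝ≥0∞ → ℝ≥0∞ → ℝ≥0∞
  | 0 => fun k s _ w => S.stopCost k s w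
  | n + 1 => fun k s u w => min (S.stopCost k s w)
      (ENNReal.ofReal S.c * S.changedWeight k s u w + S.expectNext (valueIter n) k s u w)

/-- Minimal cost of continuing and stopping within the `n` slots after the next one. -/
noncomputable def contCost (n k : ℕ) (s : NetState N) (u w : ℝ≥0∞) : ℝ≥0∞ :=
  ENNReal.ofReal S.c * S.changedWeight k s u w + S.expectNext (S.valueIter n) k s u w

theorem valueIter_succ (n k : ℕ) (s : NetState N) (u w : ℝ≥0∞) :
    S.valueIter (n + 1) k s u w = min (S.stopCost k s w) (S.contCost n k s u w) := rfl

/-! ### Measurability of the costs -/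

theorem measurable_next (k : ℕ) (s : NetState N) (o : Fin (N + 1)) :
    Measurable fun x : (ℝ≥0∞ × ℝ≥0∞) × (Fin N → 𝒳 ⊕ Unit) =>
      (S.nextEarly k s o x.2 x.1.1 x.1.2, S.nextLate k s o x.2 x.1.2) := by
  have h : ∀ t, Measurable fun x : (ℝ≥0∞ × ℝ≥0∞) × (Fin N → 𝒳 ⊕ Unit) =>
      S.deliveryDensity t s o x.2 := fun t =>
    (S.measurable_deliveryDensity t s o).comp measurable_snd
  have hu : Measurable fun x : (ℝ≥0∞ × ℝ≥0∞) × (Fin N → 𝒳 ⊕ Unit) => x.1.1 :=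
    measurable_fst.comp measurable_fst
  have hw : Measurable fun x : (ℝ≥0∞ × ℝ≥0∞) × (Fin N → 𝒳 ⊕ Unit) => x.1.2 :=
    measurable_snd.comp measurable_fst
  exact ((hu.mul (h _)).add ((hw.const_mul _).mul (h _))).prodMk ((hw.const_mul _).mul (h _))

theorem measurable_expectNext {V : ℕ → NetState N → ℝ≥0∞ → ℝ≥0∞ → ℝ≥0∞}
    (hV : ∀ k s, Measurable fun x : ℝ≥0∞ × ℝ≥0∞ => V k s x.1 x.2) (k : ℕ) (s : NetState N) :
    Measurable fun x : ℝ≥0∞ × ℝ≥0∞ => S.expectNext V k s x.1 x.2 := by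
  refine Finset.measurable_fun_sum _ fun o _ => Measurable.const_mul ?_ _
  exact Measurable.lintegral_prod_right' (ν := S.deliveryLaw s o)
    ((hV (k + 1) (netStep S.m k s o)).comp (S.measurable_next k s o))

theorem measurable_valueIter (n k : ℕ) (s : NetState N) :
    Measurable fun x : ℝ≥0∞ × ℝ≥0∞ => S.valueIter n k s x.1 x.2 := by
  have hle_cost : ∀ k (s : NetState N), Measurable fun x : ℝ≥0∞ × ℝ≥0∞ => S.stopCost k s x.2 :=
    fun k s => measurable_snd.const_mul _
  induction n generalizing k s with
  | zero => exact hle_cost k s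
  | succ n ih =>
    refine (hle_cost k s).min (Measurable.add (Measurable.const_mul ?_ _) ?_)
    · exact measurable_fst.add (measurable_snd.const_mul _)
    · exact S.measurable_expectNext ih k s

theorem measurable_valueIter_next (n k : ℕ) (s : NetState N) (o : Fin (N + 1)) (u w : ℝ≥0∞) :
    Measurable fun y => S.valueIter n (k + 1) (netStep S.m k s o) (S.nextEarly k s o y u w)
      (S.nextLate k s o y w) :=
  ((S.measurable_valueIter n (k + 1) (netStep S.m k s o)).comp (S.measurable_next k s o)).comp
    (measurable_prodMk_left (x := (u, w)))

/-! ### Homogeneity, monotonicity and Lipschitz bounds -/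

theorem stopCost_mul (t : ℝ≥0∞) (k : ℕ) (s : NetState N) (w : ℝ≥0∞) :
    S.stopCost k s (t * w) = t * S.stopCost k s w := by
  unfold stopCost
  ring

theorem nextLate_mul (t : ℝ≥0∞) (k : ℕ) (s : NetState N) (o : Fin (N + 1))
    (y : Fin N → 𝒳 ⊕ Unit) (w : ℝ≥0∞) :
    S.nextLate k s o y (t * w) = t * S.nextLate k s o y w := by
  unfold nextLate
  ring

theorem nextEarly_mul (t : ℝ≥0∞) (k : ℕ) (s : NetState N) (o : Fin (N + 1))
    (y : Fin N → 𝒳 ⊕ Unit) (u w : ℝ≥0∞) :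
    S.nextEarly k s o y (t * u) (t * w) = t * S.nextEarly k s o y u w := by
  unfold nextEarly
  ring

theorem expectNext_mul {V : ℕ → NetState N → ℝ≥0∞ → ℝ≥0∞ → ℝ≥0∞} {t : ℝ≥0∞} (ht : t ≠ ∞)
    (hV : ∀ k s u w, V k s (t * u) (t * w) = t * V k s u w) (k : ℕ) (s : NetState N)
    (u w : ℝ≥0∞) : S.expectNext V k s (t * u) (t * w) = t * S.expectNext V k s u w := by
  unfold expectNext
  rw [Finset.mul_sum]
  refine Finset.sum_congr rfl fun o _ => ?_
  simp only [nextEarly_mul, nextLate_mul, hV]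
  rw [lintegral_const_mul' _ _ ht]
  ring

theorem changedWeight_mul (t : ℝ≥0∞) (k : ℕ) (s : NetState N) (u w : ℝ≥0∞) :
    S.changedWeight k s (t * u) (t * w) = t * S.changedWeight k s u w := by
  unfold changedWeight
  ring

/-- Homogeneity permits unnormalized weights throughout. Finiteness of `t` lets it be taken out of
the integrals without a measurability condition. -/
theorem valueIter_mul {t : ℝ≥0∞} (ht : t ≠ ∞) (n k : ℕ) (s : NetState N) (u w : ℝ≥0∞) :
    S.valueIter n k s (t * u) (t * w) = t * S.valueIter n k s u w := by
  induction n generalizing k s u w with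
  | zero => exact S.stopCost_mul t k s w
  | succ n ih =>
    simp only [valueIter, stopCost_mul, changedWeight_mul, S.expectNext_mul ht ih]
    rw [(show Monotone fun x : ℝ≥0∞ => t * x from fun _ _ h => mul_le_mul_right h t).map_min]
    ring_nf

theorem contCost_mul {t : ℝ≥0∞} (ht : t ≠ ∞) (n k : ℕ) (s : NetState N) (u w : ℝ≥0∞) :
    S.contCost n k s (t * u) (t * w) = t * S.contCost n k s u w := by
  unfold contCost
  rw [changedWeight_mul, S.expectNext_mul ht (S.valueIter_mul ht n)]
  ring

/-- With two cost functions, this covers both monotonicity in the weights and the comparison of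
`value` with its approximations. -/
theorem expectNext_mono {V V' : ℕ → NetState N → ℝ≥0∞ → ℝ≥0∞ → ℝ≥0∞} {k : ℕ} {s : NetState N}
    {u u' w w' : ℝ≥0∞} (hV : ∀ k s u u' w w', u ≤ u' → w ≤ w' → V k s u w ≤ V' k s u' w')
    (hu : u ≤ u') (hw : w ≤ w') : S.expectNext V k s u w ≤ S.expectNext V' k s u' w' := by
  unfold expectNext
  gcongr with o _ y
  apply hV
  · unfold nextEarly
    gcongr
  · unfold nextLate
    gcongr

theorem valueIter_mono (n k : ℕ) (s : NetState N) {u u' w w' : ℝ≥0∞} (hu : u ≤ u') (hw : w ≤ w') :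
    S.valueIter n k s u w ≤ S.valueIter n k s u' w' := by
  induction n generalizing k s u u' w w' with
  | zero =>
    simp only [valueIter, stopCost]
    gcongr
  | succ n ih =>
    simp only [valueIter, stopCost, changedWeight]
    have := S.expectNext_mono (k := k) (s := s) (fun k s u u' w w' h h' => ih k s h h') hu hw
    gcongr

theorem contCost_mono (n k : ℕ) (s : NetState N) {u u' w w' : ℝ≥0∞} (hu : u ≤ u') (hw : w ≤ w') :
    S.contCost n k s u w ≤ S.contCost n k s u' w' := by
  simp only [contCost, changedWeight]
  have := S.expectNext_mono (k := k) (s := s)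
    (fun k s u u' w w' h h' => S.valueIter_mono n k s h h') hu hw
  gcongr

/-- Additional weight `v` on a past change costs at most `c * v` in each slot before the horizon:
the delivery density multiplying it integrates to one, and stopping is free on this weight. The
hypothesis `hn` is the induction hypothesis of `valueIter_add_le`. -/
theorem contCost_add_le {n : ℕ}
    (hn : ∀ k (s : NetState N) u v w, S.valueIter n k s (u + v) w ≤
      S.valueIter n k s u w + n * ENNReal.ofReal S.c * v) (k : ℕ) (s : NetState N)
    (u v w : ℝ≥0∞) :
    S.contCost n k s (u + v) w ≤
      S.contCost n k s u w + (n + 1 : ℕ) * ENNReal.ofReal S.c * v := by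
  set C := ENNReal.ofReal S.c
  have h : S.expectNext (S.valueIter n) k s (u + v) w ≤
      S.expectNext (S.valueIter n) k s u w + n * C * v := by
    calc S.expectNext (S.valueIter n) k s (u + v) w
        ≤ ∑ o, S.outcomeWeight s o * (∫⁻ y, S.valueIter n (k + 1) (netStep S.m k s o)
            (S.nextEarly k s o y u w) (S.nextLate k s o y w) ∂S.deliveryLaw s o +
              n * C * v) := by
          unfold expectNext
          gcongr with o
          calc _ ≤ ∫⁻ y, (S.valueIter n (k + 1) (netStep S.m k s o)
                (S.nextEarly k s o y u w) (S.nextLate k s o y w) +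
                  n * C * v * S.deliveryDensity (refTime S.m k s) s o y) ∂S.deliveryLaw s o := by
                refine lintegral_mono fun y => ?_
                have h1 : S.nextEarly k s o y (u + v) w = S.nextEarly k s o y u w +
                    v * S.deliveryDensity (refTime S.m k s) s o y := by
                  unfold nextEarly
                  ring
                simp only [h1]
                refine (hn _ _ _ _ _).trans (le_of_eq ?_)
                ring
            _ = _ := by
                rw [lintegral_add_left (S.measurable_valueIter_next n k s o u w),
                  lintegral_const_mul _ (S.measurable_deliveryDensity _ s o),
                  lintegral_deliveryDensity, mul_one]
      _ = _ := by
          simp only [mul_add, Finset.sum_add_distrib]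
          rw [← Finset.sum_mul, sum_outcomeWeight, one_mul]
          rfl
  calc S.contCost n k s (u + v) w
      = C * S.changedWeight k s u w + C * v + S.expectNext (S.valueIter n) k s (u + v) w := by
        unfold contCost changedWeight
        ring
    _ ≤ C * S.changedWeight k s u w + C * v +
        (S.expectNext (S.valueIter n) k s u w + n * C * v) := by gcongr
    _ = _ := by
        unfold contCost
        push_cast
        ring

theorem valueIter_add_le (n k : ℕ) (s : NetState N) (u v w : ℝ≥0∞) :
    S.valueIter n k s (u + v) w ≤ S.valueIter n k s u w + n * ENNReal.ofReal S.c * v := by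
  induction n generalizing k s u v w with
  | zero => simp [valueIter]
  | succ n ih =>
    rw [valueIter_succ, valueIter_succ, min_add]
    exact min_le_min le_self_add (S.contCost_add_le ih k s u v w)

theorem contCost_add_le' (n k : ℕ) (s : NetState N) (u v w : ℝ≥0∞) :
    S.contCost n k s (u + v) w ≤ S.contCost n k s u w + (n + 1 : ℕ) * ENNReal.ofReal S.c * v :=
  S.contCost_add_le (S.valueIter_add_le n) k s u v w

/-! ### The stopping boundary -/

/-- Stopping costs no more than continuing. -/
def StopOptimal (k : ℕ) (s : NetState N) (u w : ℝ≥0∞) : Prop :=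
  ∀ n, S.stopCost k s w ≤ S.contCost n k s u w

theorem stopOptimal_mul_iff {t : ℝ≥0∞} (h0 : t ≠ 0) (ht : t ≠ ∞) (k : ℕ) (s : NetState N)
    (u w : ℝ≥0∞) : S.StopOptimal k s (t * u) (t * w) ↔ S.StopOptimal k s u w := by
  unfold StopOptimal
  refine forall_congr' fun n => ?_
  rw [stopCost_mul, S.contCost_mul ht]
  exact ENNReal.mul_le_mul_iff_right h0 ht

/-- Conditional probabilities of a change after the reference time at which it is optimal
to stop. -/
def stopSet (k : ℕ) (s : NetState N) : Set ℝ :=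
  {x | x ∈ Set.Icc (0 : ℝ) 1 ∧ S.StopOptimal k s (ENNReal.ofReal (1 - x)) (ENNReal.ofReal x)}

/-- The largest conditional probability of a change after the reference time at which it is
optimal to stop. -/
noncomputable def boundary (k : ℕ) (s : NetState N) : ℝ := sSup (S.stopSet k s)

theorem zero_mem_stopSet (k : ℕ) (s : NetState N) : 0 ∈ S.stopSet k s :=
  ⟨by simp, fun n => by simp [stopCost]⟩

theorem bddAbove_stopSet (k : ℕ) (s : NetState N) : BddAbove (S.stopSet k s) :=
  ⟨1, fun _ hx => hx.1.2⟩

theorem boundary_mem_Icc (k : ℕ) (s : NetState N) : S.boundary k s ∈ Set.Icc (0 : ℝ) 1 :=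
  ⟨le_csSup (S.bddAbove_stopSet k s) (S.zero_mem_stopSet k s),
    csSup_le ⟨0, S.zero_mem_stopSet k s⟩ fun _ hx => hx.1.2⟩

/-- Scaling by `y / x` turns the late weight `x` into `y` and preserves the inequality; the early
weight becomes at most `1 - y`. Raising it to `1 - y` can only increase the cost of continuing and
leaves the stopping cost unchanged. -/
theorem mem_stopSet_of_le {k : ℕ} {s : NetState N} {x y : ℝ} (hx : x ∈ S.stopSet k s)
    (hy : 0 ≤ y) (hyx : y ≤ x) : y ∈ S.stopSet k s := by
  rcases hy.eq_or_lt with rfl | hy0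
  · exact S.zero_mem_stopSet k s
  have hx0 : 0 < x := hy0.trans_le hyx
  obtain ⟨⟨-, hx1⟩, hle_cost⟩ := hx
  refine ⟨⟨hy, hyx.trans hx1⟩, fun n => ?_⟩
  have hα0 : 0 ≤ y / x := by positivity
  have hα1 : y / x ≤ 1 := (div_le_one hx0).2 hyx
  have e1 : ENNReal.ofReal y = ENNReal.ofReal (y / x) * ENNReal.ofReal x := by
    rw [← ENNReal.ofReal_mul hα0, div_mul_cancel₀ _ hx0.ne']
  have e2 : ENNReal.ofReal (y / x) * ENNReal.ofReal (1 - x) ≤ ENNReal.ofReal (1 - y) := by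
    rw [← ENNReal.ofReal_mul hα0]
    refine ENNReal.ofReal_le_ofReal ?_
    rw [mul_sub, div_mul_cancel₀ _ hx0.ne']
    linarith
  calc S.stopCost k s (ENNReal.ofReal y)
      = ENNReal.ofReal (y / x) * S.stopCost k s (ENNReal.ofReal x) := by rw [e1, stopCost_mul]
    _ ≤ ENNReal.ofReal (y / x) * S.contCost n k s (ENNReal.ofReal (1 - x)) (ENNReal.ofReal x) := by
        gcongr
        exact hle_cost n
    _ = S.contCost n k s (ENNReal.ofReal (y / x) * ENNReal.ofReal (1 - x)) (ENNReal.ofReal y) := by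
        rw [e1, S.contCost_mul ENNReal.ofReal_ne_top]
    _ ≤ _ := S.contCost_mono n k s e2 le_rfl

/-- Points `y` below the supremum belong to the set. The continuation cost at `y` exceeds the one at
`x` by at most a multiple of `x - y`, so the inequality survives the limit from the left. -/
theorem boundary_mem_stopSet (k : ℕ) (s : NetState N) : S.boundary k s ∈ S.stopSet k s := by
  set x := S.boundary k s with hx
  obtain ⟨hx0, hx1⟩ := S.boundary_mem_Icc k s
  rcases hx0.eq_or_lt with h0 | h0
  · rw [hx, ← h0]
    exact S.zero_mem_stopSet k s
  refine ⟨⟨hx0, hx1⟩, fun n => ?_⟩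
  set K : ℝ≥0∞ := (n + 1 : ℕ) * ENNReal.ofReal S.c
  have hK : K ≠ ∞ := ENNReal.mul_ne_top (ENNReal.natCast_ne_top _) ENNReal.ofReal_ne_top
  have hev : ∀ᶠ y in nhdsWithin x (Set.Iio x), S.stopCost k s (ENNReal.ofReal y) ≤
      S.contCost n k s (ENNReal.ofReal (1 - x)) (ENNReal.ofReal x) +
        K * ENNReal.ofReal (x - y) := by
    filter_upwards [Ioo_mem_nhdsLT h0] with y hy
    obtain ⟨z, hz, hyz⟩ := exists_lt_of_lt_csSup ⟨0, S.zero_mem_stopSet k s⟩ hy.2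
    have hmem := S.mem_stopSet_of_le hz hy.1.le hyz.le
    calc S.stopCost k s (ENNReal.ofReal y)
        ≤ S.contCost n k s (ENNReal.ofReal (1 - y)) (ENNReal.ofReal y) := hmem.2 n
      _ ≤ S.contCost n k s (ENNReal.ofReal (1 - y)) (ENNReal.ofReal x) :=
          S.contCost_mono n k s le_rfl (ENNReal.ofReal_le_ofReal hy.2.le)
      _ = S.contCost n k s (ENNReal.ofReal (1 - x) + ENNReal.ofReal (x - y))
            (ENNReal.ofReal x) := by
          rw [← ENNReal.ofReal_add (by linarith) (by linarith [hy.2])]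
          ring_nf
      _ ≤ _ := S.contCost_add_le' n k s _ _ _
  have hle : nhdsWithin x (Set.Iio x) ≤ nhds x := nhdsWithin_le_nhds
  have hl : Filter.Tendsto (fun y => S.stopCost k s (ENNReal.ofReal y))
      (nhdsWithin x (Set.Iio x)) (nhds (S.stopCost k s (ENNReal.ofReal x))) := by
    refine Filter.Tendsto.mono_left ?_ hle
    exact ((ENNReal.continuous_const_mul ENNReal.ofReal_ne_top).comp
      ENNReal.continuous_ofReal).tendsto x
  have hr : Filter.Tendsto (fun y => S.contCost n k s (ENNReal.ofReal (1 - x)) (ENNReal.ofReal x) +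
        K * ENNReal.ofReal (x - y)) (nhdsWithin x (Set.Iio x))
      (nhds (S.contCost n k s (ENNReal.ofReal (1 - x)) (ENNReal.ofReal x) +
        K * ENNReal.ofReal (x - x))) := by
    refine Filter.Tendsto.mono_left ?_ hle
    exact (continuous_const.add ((ENNReal.continuous_const_mul hK).comp
      (ENNReal.continuous_ofReal.comp (continuous_const.sub continuous_id)))).tendsto x
  simpa using le_of_tendsto_of_tendsto hl hr hev

/-- Homogeneity reduces the weights to the normalized pair `(1 - x, x)`, and the stopping set is the
interval from 0 to its largest element. -/
theorem stopOptimal_iff {k : ℕ} {s : NetState N} {u w : ℝ≥0∞} (h0 : u + w ≠ 0)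
    (ht : u + w ≠ ∞) : S.StopOptimal k s u w ↔ (w / (u + w)).toReal ≤ S.boundary k s := by
  have hw : w ≤ u + w := le_add_self
  set x := (w / (u + w)).toReal with hx
  have hx' : ENNReal.ofReal x = w / (u + w) :=
    ENNReal.ofReal_toReal (ENNReal.div_ne_top (ne_top_of_le_ne_top ht hw) h0)
  have hx0 : 0 ≤ x := ENNReal.toReal_nonneg
  have hx1 : x ≤ 1 := by
    rw [← ENNReal.ofReal_le_ofReal_iff zero_le_one, hx', ENNReal.ofReal_one]
    exact ENNReal.div_le_of_le_mul (by rwa [one_mul])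
  have hxu : ENNReal.ofReal (1 - x) = u / (u + w) := by
    rw [ENNReal.ofReal_sub _ hx0, hx', ENNReal.ofReal_one]
    refine ENNReal.sub_eq_of_eq_add (ENNReal.div_ne_top (ne_top_of_le_ne_top ht hw) h0) ?_
    rw [ENNReal.div_add_div_same, ENNReal.div_self h0 ht]
  have e1 : (u + w) * ENNReal.ofReal (1 - x) = u := by rw [hxu, ENNReal.mul_div_cancel h0 ht]
  have e2 : (u + w) * ENNReal.ofReal x = w := by rw [hx', ENNReal.mul_div_cancel h0 ht]
  have h1 : S.StopOptimal k s u w ↔ x ∈ S.stopSet k s := by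
    have h := S.stopOptimal_mul_iff h0 ht k s (ENNReal.ofReal (1 - x)) (ENNReal.ofReal x)
    rw [e1, e2] at h
    exact h.trans ⟨fun h => ⟨⟨hx0, hx1⟩, h⟩, fun h => h.2⟩
  rw [h1]
  exact ⟨fun h => le_csSup (S.bddAbove_stopSet k s) h,
    fun h => S.mem_stopSet_of_le (S.boundary_mem_stopSet k s) hx0 h⟩

/-! ### The value function -/

/-- Minimal cost of stopping. -/
noncomputable def value (k : ℕ) (s : NetState N) (u w : ℝ≥0∞) : ℝ≥0∞ :=
  ⨅ n, S.valueIter n k s u w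

theorem measurable_value (k : ℕ) (s : NetState N) :
    Measurable fun x : ℝ≥0∞ × ℝ≥0∞ => S.value k s x.1 x.2 :=
  Measurable.iInf fun n => S.measurable_valueIter n k s

theorem stopCost_le_value {k : ℕ} {s : NetState N} {u w : ℝ≥0∞} (h : S.StopOptimal k s u w) :
    S.stopCost k s w ≤ S.value k s u w := by
  refine le_iInf fun n => ?_
  cases n with
  | zero => exact le_rfl
  | succ n => exact le_min le_rfl (h n)

/-- Some horizon `n₀` makes continuing cheaper than stopping, so the stopping cost too dominates the
continuation value. Only the easy inequality is needed: the expectation of an infimum is at most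
each expectation. -/
theorem contValue_le_value {k : ℕ} {s : NetState N} {u w : ℝ≥0∞} (h : ¬ S.StopOptimal k s u w) :
    ENNReal.ofReal S.c * S.changedWeight k s u w + S.expectNext S.value k s u w ≤
      S.value k s u w := by
  have hle : ∀ n, ENNReal.ofReal S.c * S.changedWeight k s u w + S.expectNext S.value k s u w ≤
      S.contCost n k s u w := fun n => by
    unfold contCost
    gcongr
    exact S.expectNext_mono (fun k s u u' w w' h h' =>
      (iInf_le _ n).trans (S.valueIter_mono n k s h h')) le_rfl le_rfl
  unfold StopOptimal at h
  push Not at h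
  obtain ⟨n₀, hn₀⟩ := h
  refine le_iInf fun n => ?_
  cases n with
  | zero => exact (hle n₀).trans hn₀.le
  | succ n => exact le_min ((hle n₀).trans hn₀.le) (hle n)

end Setting

end NADM

namespace NADM

/-! ### Histories -/

/-- The outcome of a slot, and the samples handed over as a result. -/
abbrev SlotObs (N : ℕ) (𝒳 : Type*) := Fin (N + 1) × (Fin N → 𝒳 ⊕ Unit)

/-- What can be observed in the first `k` slots. -/
@[reducible] def Hist.{u} (N : ℕ) (𝒳 : Type u) : ℕ → Type u
  | 0 => PUnit
  | k + 1 => Hist N 𝒳 k × SlotObs N 𝒳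

@[reducible] instance instMeasurableSpaceHist (N : ℕ) (𝒳 : Type*) [MeasurableSpace 𝒳] :
    ∀ k, MeasurableSpace (Hist N 𝒳 k)
  | 0 => (⊤ : MeasurableSpace PUnit)
  | k + 1 => @Prod.instMeasurableSpace _ _ (instMeasurableSpaceHist N 𝒳 k) inferInstance

/-- The configuration after the history `h`. -/
noncomputable def histState {N : ℕ} {𝒳 : Type*} (m : ℕ) : ∀ k, Hist N 𝒳 k → NetState N
  | 0 => fun _ => ⟨1, fun _ => 0, fun _ => 0, fun _ => false⟩
  | k + 1 => fun h => netStep m k (histState m k h.1) h.2.1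

/-- Only nodes with a nonempty queue transmit. -/
def Plausible {N : ℕ} {𝒳 : Type*} (m : ℕ) : ∀ k, Hist N 𝒳 k → Prop
  | 0 => fun _ => True
  | k + 1 => fun h => Plausible m k h.1 ∧ Possible (histState m k h.1) h.2.1

theorem Plausible.reachable {N : ℕ} {𝒳 : Type*} {m : ℕ} (hm : 1 ≤ m) {k : ℕ} {h : Hist N 𝒳 k}
    (hh : Plausible m k h) : Reachable m k (histState m k h) := by
  induction k with
  | zero => exact reachable_zero m fun _ => 0
  | succ k ih => exact (ih hh.1).netStep hm hh.2

section

variable {𝒳 : Type*} [MeasurableSpace 𝒳] {N : ℕ}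

theorem measurable_histState (m k : ℕ) : Measurable (histState (N := N) (𝒳 := 𝒳) m k) := by
  induction k with
  | zero => exact measurable_const
  | succ k ih =>
    exact (measurable_of_countable
      (fun x : NetState N × Fin (N + 1) => netStep m k x.1 x.2)).comp
        ((ih.comp measurable_fst).prodMk (measurable_fst.comp measurable_snd))

/-- Configurations and outcomes form a countable discrete space, so measurability may be checked
with both frozen. -/
theorem measurable_of_forall_slot {H γ : Type*} [MeasurableSpace H] [MeasurableSpace γ]
    {G : H → NetState N} (hG : Measurable G) {f : NetState N → Fin (N + 1) →
      H → (Fin N → 𝒳 ⊕ Unit) → γ}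
    (hf : ∀ s o, Measurable fun x : H × (Fin N → 𝒳 ⊕ Unit) => f s o x.1 x.2) :
    Measurable fun h : H × SlotObs N 𝒳 => f (G h.1) h.2.1 h.1 h.2.2 := by
  have h1 : Measurable fun q : (NetState N × Fin (N + 1)) × (H × (Fin N → 𝒳 ⊕ Unit)) =>
      f q.1.1 q.1.2 q.2.1 q.2.2 := measurable_from_prod_countable_right fun x => hf x.1 x.2
  have h2 : Measurable fun h : H × SlotObs N 𝒳 => ((G h.1, h.2.1), (h.1, h.2.2)) := by fun_prop
  exact h1.comp h2

theorem measurableSet_plausible (m k : ℕ) :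
    MeasurableSet {h : Hist N 𝒳 k | Plausible m k h} := by
  induction k with
  | zero => exact MeasurableSet.univ
  | succ k ih =>
    refine (measurable_fst ih).inter ?_
    exact ((measurable_histState m k).comp measurable_fst).prodMk
      (measurable_fst.comp measurable_snd)
        (Set.to_countable {x : NetState N × Fin (N + 1) | Possible x.1 x.2}).measurableSet

end

namespace Setting

variable {𝒳 : Type*} [MeasurableSpace 𝒳] (S : Setting 𝒳) {N : ℕ}

/-- Reference law of the observation in a slot. -/
noncomputable def slotLaw (s : NetState N) : Measure (SlotObs N 𝒳) :=
  ∑ o, S.outcomeWeight s o • (S.deliveryLaw s o).map (Prod.mk o)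

theorem lintegral_slotLaw (s : NetState N) {g : SlotObs N 𝒳 → ℝ≥0∞} (hg : Measurable g) :
    ∫⁻ z, g z ∂S.slotLaw s = ∑ o, S.outcomeWeight s o * ∫⁻ y, g (o, y) ∂S.deliveryLaw s o := by
  unfold slotLaw
  rw [lintegral_finsetSum_measure]
  refine Finset.sum_congr rfl fun o _ => ?_
  rw [lintegral_smul_measure, lintegral_map hg measurable_prodMk_left, smul_eq_mul]

instance (s : NetState N) : IsProbabilityMeasure (S.slotLaw s) where
  measure_univ := by
    rw [← lintegral_one, S.lintegral_slotLaw s measurable_const]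
    simp [S.sum_outcomeWeight]

/-- Reference law of the observation in a slot, as a Markov kernel. -/
noncomputable def slotKernel : Kernel (NetState N) (SlotObs N 𝒳) :=
  Kernel.ofFunOfCountable S.slotLaw

instance : IsMarkovKernel (S.slotKernel (N := N)) :=
  ⟨fun s => inferInstanceAs (IsProbabilityMeasure (S.slotLaw s))⟩

/-- Reference law of the history. -/
noncomputable def refLaw (N : ℕ) : ∀ k, Measure (Hist N 𝒳 k)
  | 0 => Measure.dirac PUnit.unit
  | k + 1 => (refLaw N k) ⊗ₘ (S.slotKernel.comap (histState S.m k) (measurable_histState S.m k))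

instance isProbabilityMeasure_refLaw (k : ℕ) : IsProbabilityMeasure (S.refLaw N k) := by
  induction k with
  | zero => exact Measure.dirac.isProbabilityMeasure
  | succ k ih =>
    exact inferInstanceAs (IsProbabilityMeasure ((S.refLaw N k) ⊗ₘ
      (S.slotKernel.comap (histState S.m k) (measurable_histState S.m k))))

theorem lintegral_refLaw_succ (k : ℕ) {g : Hist N 𝒳 k × SlotObs N 𝒳 → ℝ≥0∞} (hg : Measurable g) :
    ∫⁻ h, g h ∂S.refLaw N (k + 1) = ∫⁻ h, ∑ o, S.outcomeWeight (histState S.m k h) o *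
      ∫⁻ y, g (h, (o, y)) ∂S.deliveryLaw (histState S.m k h) o ∂S.refLaw N k := by
  refine (Measure.lintegral_compProd hg).trans (lintegral_congr fun h => ?_)
  exact S.lintegral_slotLaw _ (hg.comp measurable_prodMk_left)

theorem ae_possible (s : NetState N) : ∀ᵐ z ∂S.slotLaw s, Possible s z.1 := by
  have hmeas : MeasurableSet {z : SlotObs N 𝒳 | ¬ Possible s z.1} :=
    measurable_fst (Set.to_countable {o : Fin (N + 1) | ¬ Possible s o}).measurableSet
  rw [ae_iff, ← lintegral_indicator_one hmeas, S.lintegral_slotLaw s (measurable_one.indicator hmeas)]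
  refine Finset.sum_eq_zero fun o _ => ?_
  by_cases ho : S.outcomeWeight s o = 0
  · rw [ho, zero_mul]
  · have := S.possible_of_outcomeWeight_ne_zero ho
    simp [this]

theorem ae_plausible (k : ℕ) : ∀ᵐ h ∂S.refLaw N k, Plausible S.m k h := by
  induction k with
  | zero => exact ae_of_all _ fun _ => trivial
  | succ k ih =>
    refine (Measure.ae_compProd_iff (measurableSet_plausible S.m (k + 1))).2 ?_
    filter_upwards [ih] with h hh
    filter_upwards [S.ae_possible (histState S.m k h)] with z hz
    exact ⟨hh, hz⟩

/-- Likelihood of a history when the change occurs at time `t`. -/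
noncomputable def likelihood (t : ℕ) : ∀ k, Hist N 𝒳 k → ℝ≥0∞
  | 0 => fun _ => 1
  | k + 1 => fun h => likelihood t k h.1 *
      S.deliveryDensity t (histState S.m k h.1) h.2.1 h.2.2

theorem measurable_likelihood (t k : ℕ) : Measurable (S.likelihood (N := N) t k) := by
  induction k with
  | zero => exact measurable_const
  | succ k ih =>
    exact (ih.comp measurable_fst).mul (measurable_of_forall_slot (measurable_histState S.m k)
      (f := fun s o _ y => S.deliveryDensity t s o y)
      fun s o => (S.measurable_deliveryDensity t s o).comp measurable_snd)

/-- All samples received were taken no later than the reference time, hence before either change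
time: each has law `F₀` in both cases. -/
theorem likelihood_congr {t t' k : ℕ} {h : Hist N 𝒳 k} (hh : Plausible S.m k h)
    (ht : refTime S.m k (histState S.m k h) < t) (ht' : refTime S.m k (histState S.m k h) < t') :
    S.likelihood t k h = S.likelihood t' k h := by
  induction k with
  | zero => rfl
  | succ k ih =>
    have hr := refTime_le_netStep S.m k (histState S.m k h.1) h.2.1
    change refTime S.m (k + 1) (netStep S.m k (histState S.m k h.1) h.2.1) < _ at ht ht'
    have hd : S.deliveryDensity t (histState S.m k h.1) h.2.1 =
        S.deliveryDensity t' (histState S.m k h.1) h.2.1 :=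
      S.deliveryDensity_congr fun i b hb => by
        have := ((hh.1.reachable S.one_le_m).refTime_le_of_delivered hh.2 hb).2.1
        omega
    simp only [likelihood]
    rw [ih hh.1 (by omega) (by omega), hd]

/-- The first `k ≤ m` slots hand over nothing, so the history says nothing about the change. -/
theorem likelihood_eq_one {t k : ℕ} {h : Hist N 𝒳 k} (hh : Plausible S.m k h) (hk : k ≤ S.m) :
    S.likelihood t k h = 1 := by
  induction k with
  | zero => rfl
  | succ k ih =>
    simp only [likelihood]
    rw [ih hh.1 (by omega), one_mul]
    refine Finset.prod_eq_one fun i _ => ?_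
    rw [(hh.1.reachable S.one_le_m).delivered_eq_none (by omega) hh.2 i]
    rfl

/-! ### Prior weights -/

/-- Prior probability of a change at time `t`. -/
noncomputable def prior (ρ : ℝ) (t : ℕ) : ℝ≥0∞ :=
  ENNReal.ofReal (if t = 0 then ρ else (1 - ρ) * (S.p * (1 - S.p) ^ (t - 1)))

/-- Prior probability of a change after time `t`. -/
noncomputable def priorTail (ρ : ℝ) (t : ℕ) : ℝ≥0∞ := ENNReal.ofReal ((1 - ρ) * (1 - S.p) ^ t)

variable {ρ : ℝ}

/-- This is memorylessness. The atom at 0 only scales the tail by `1 - ρ`, which is why `ρ` never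
enters the recursion. -/
theorem priorTail_add (hρ : ρ ≤ 1) (i j : ℕ) :
    S.priorTail ρ (i + j) = S.priorTail ρ i * S.survival j := by
  unfold priorTail survival
  rw [← ENNReal.ofReal_mul (mul_nonneg (by linarith) (S.pow_nonneg_p i)), pow_add, mul_assoc]

/-- The summation starts at `i + 1`, which avoids the modified atom at 0. -/
theorem sum_prior (hρ : ρ ≤ 1) (i j : ℕ) :
    ∑ l ∈ Finset.range j, S.prior ρ (i + 1 + l) = S.priorTail ρ i * S.onset j := by
  have hp := S.p_pos
  unfold prior priorTail onset
  rw [← ENNReal.ofReal_sum_of_nonneg, ← ENNReal.ofReal_mul (mul_nonneg (by linarith) (S.pow_nonneg_p i))]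
  · congr 1
    induction j with
    | zero => simp
    | succ j ih =>
      rw [Finset.sum_range_succ, ih, if_neg (by omega), show i + 1 + j - 1 = i + j by omega,
        pow_add, pow_succ]
      ring
  · intro l _
    rw [if_neg (by omega)]
    exact mul_nonneg (by linarith) (mul_nonneg hp.le (S.pow_nonneg_p _))

theorem tsum_prior (hρ : ρ ≤ 1) (i : ℕ) : ∑' l, S.prior ρ (i + 1 + l) = S.priorTail ρ i := by
  refine tendsto_nhds_unique (ENNReal.tendsto_nat_tsum _) ?_
  simp only [S.sum_prior hρ]
  have h : Filter.Tendsto (fun j : ℕ => S.onset j) Filter.atTop (nhds 1) := by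
    unfold onset
    have := (tendsto_pow_atTop_nhds_zero_of_lt_one (r := 1 - S.p) (by linarith [S.p_lt_one])
      (by linarith [S.p_pos])).const_sub 1
    rw [sub_zero] at this
    simpa using ENNReal.tendsto_ofReal this
  simpa using ENNReal.Tendsto.const_mul (a := S.priorTail ρ i) h
    (Or.inr (by unfold priorTail; exact ENNReal.ofReal_ne_top))

/-- Unnormalized posterior weight of a change up to the reference time. -/
noncomputable def early (ρ : ℝ) (k : ℕ) (h : Hist N 𝒳 k) : ℝ≥0∞ :=
  ∑ t ∈ Finset.range (refTime S.m k (histState S.m k h) + 1), S.prior ρ t * S.likelihood t k h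

/-- Unnormalized posterior weight of a change after the reference time. -/
noncomputable def late (ρ : ℝ) (k : ℕ) (h : Hist N 𝒳 k) : ℝ≥0∞ :=
  S.priorTail ρ (refTime S.m k (histState S.m k h)) *
    S.likelihood (refTime S.m k (histState S.m k h) + 1) k h

theorem measurable_of_forall_state {γ : Type*} [MeasurableSpace γ] {k : ℕ}
    {f : NetState N → Hist N 𝒳 k → γ} (hf : ∀ s, Measurable (f s)) :
    Measurable fun h => f (histState S.m k h) h :=
  (measurable_from_prod_countable_right (f := fun x : NetState N × Hist N 𝒳 k => f x.1 x.2) hf).comp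
    ((measurable_histState S.m k).prodMk measurable_id)

theorem measurable_early (k : ℕ) : Measurable (S.early (N := N) ρ k) :=
  S.measurable_of_forall_state (f := fun s h => ∑ t ∈ Finset.range (refTime S.m k s + 1),
    S.prior ρ t * S.likelihood t k h) fun _ =>
      Finset.measurable_fun_sum _ fun t _ => (S.measurable_likelihood t k).const_mul _

theorem measurable_late (k : ℕ) : Measurable (S.late (N := N) ρ k) :=
  S.measurable_of_forall_state (f := fun s h => S.priorTail ρ (refTime S.m k s) *
    S.likelihood (refTime S.m k s + 1) k h) fun _ => (S.measurable_likelihood _ k).const_mul _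

theorem sum_range_add_of_le {f : ℕ → ℝ≥0∞} {i j : ℕ} (h : i ≤ j) :
    ∑ t ∈ Finset.range (j + 1), f t =
      ∑ t ∈ Finset.range (i + 1), f t + ∑ l ∈ Finset.range (j - i), f (i + 1 + l) := by
  rw [← Finset.sum_range_add, show i + 1 + (j - i) = j + 1 by omega]

theorem refTime_add (k : ℕ) (s : NetState N) :
    refTime S.m k s + (k - s.B * S.m) = k := by
  unfold refTime
  omega

/-- The weight of a change up to the present time. -/
theorem sum_prior_mul_likelihood (hρ : ρ ≤ 1) {k : ℕ} {h : Hist N 𝒳 k} (hh : Plausible S.m k h) :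
    ∑ t ∈ Finset.range (k + 1), S.prior ρ t * S.likelihood t k h =
      S.changedWeight k (histState S.m k h) (S.early ρ k h) (S.late ρ k h) := by
  have hr := S.refTime_add k (histState S.m k h)
  rw [sum_range_add_of_le (i := refTime S.m k (histState S.m k h)) (by omega), changedWeight, early,
    late, show k - refTime S.m k (histState S.m k h) = k - (histState S.m k h).B * S.m by omega]
  congr 1
  rw [← mul_assoc, mul_comm (S.onset _), ← S.sum_prior hρ, Finset.sum_mul]
  refine Finset.sum_congr rfl fun l _ => ?_
  rw [S.likelihood_congr hh (t' := refTime S.m k (histState S.m k h) + 1) (by omega) (by omega)]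

/-- The weight of a change after the present time. -/
theorem tsum_prior_mul_likelihood (hρ : ρ ≤ 1) {k : ℕ} {h : Hist N 𝒳 k}
    (hh : Plausible S.m k h) :
    ∑' l, S.prior ρ (k + 1 + l) * S.likelihood (k + 1 + l) k h =
      S.stopCost k (histState S.m k h) (S.late ρ k h) := by
  have hr := S.refTime_add k (histState S.m k h)
  rw [stopCost, late, ← mul_assoc, mul_comm (S.survival _), ← S.priorTail_add hρ, hr,
    ← S.tsum_prior hρ, ← ENNReal.tsum_mul_right]
  refine tsum_congr fun l => ?_
  rw [S.likelihood_congr hh (t' := refTime S.m k (histState S.m k h) + 1) (by omega) (by omega)]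

theorem stopCost_add_changedWeight (k : ℕ) (s : NetState N) (u w : ℝ≥0∞) :
    S.stopCost k s w + S.changedWeight k s u w = u + w := by
  unfold stopCost changedWeight
  calc _ = u + (S.survival (k - s.B * S.m) + S.onset (k - s.B * S.m)) * w := by ring
    _ = _ := by rw [survival_add_onset, one_mul]

/-- By memorylessness the tail weight drops by the survival factor over the advance of the reference
time; the likelihood of the past is the same for all change times beyond the old reference time. -/
theorem late_succ (hρ : ρ ≤ 1) {k : ℕ} {h : Hist N 𝒳 k} {z : SlotObs N 𝒳}
    (hh : Plausible S.m k h) :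
    S.late ρ (k + 1) (h, z) = S.nextLate k (histState S.m k h) z.1 z.2 (S.late ρ k h) := by
  have hr := refTime_le_netStep S.m k (histState S.m k h) z.1
  set s := histState S.m k h with hs
  set r := refTime S.m k s
  set r' := refTime S.m (k + 1) (netStep S.m k s z.1)
  have e1 : S.late ρ (k + 1) (h, z) = S.priorTail ρ r' *
    (S.likelihood (r' + 1) k h * S.deliveryDensity (r' + 1) s z.1 z.2) := rfl
  have e2 : S.late ρ k h = S.priorTail ρ r * S.likelihood (r + 1) k h := rfl
  have e3 : S.nextLate k s z.1 z.2 (S.late ρ k h) =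
    S.survival (r' - r) * S.late ρ k h * S.deliveryDensity (r' + 1) s z.1 z.2 := rfl
  rw [e1, e3, e2, S.likelihood_congr hh (t := r' + 1) (t' := r + 1)
    (show r < _ by omega) (show r < _ by omega)]
  have : S.priorTail ρ r' = S.priorTail ρ r * S.survival (r' - r) := by
    rw [← S.priorTail_add hρ, show r + (r' - r) = r' by omega]
  rw [this]
  ring

/-- Change times up to `r'` are split at `r`. Those up to `r` share the density of the new samples;
those in between share the past likelihood as well, and their prior weights add up to the onset
probability. -/
theorem early_succ (hρ : ρ ≤ 1) {k : ℕ} {h : Hist N 𝒳 k} {z : SlotObs N 𝒳}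
    (hh : Plausible S.m k h) (hz : Possible (histState S.m k h) z.1) :
    S.early ρ (k + 1) (h, z) =
      S.nextEarly k (histState S.m k h) z.1 z.2 (S.early ρ k h) (S.late ρ k h) := by
  have hr := refTime_le_netStep S.m k (histState S.m k h) z.1
  have hd : ∀ i b, delivered (histState S.m k h) z.1 i = some b → _ := fun i b hb =>
    (hh.reachable S.one_le_m).refTime_le_of_delivered hz hb
  set s := histState S.m k h with hs
  set r := refTime S.m k s
  set r' := refTime S.m (k + 1) (netStep S.m k s z.1)
  have e1 : S.early ρ (k + 1) (h, z) = ∑ t ∈ Finset.range (r' + 1), S.prior ρ t *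
    (S.likelihood t k h * S.deliveryDensity t s z.1 z.2) := rfl
  have e2 : S.late ρ k h = S.priorTail ρ r * S.likelihood (r + 1) k h := rfl
  have e3 : S.early ρ k h = ∑ t ∈ Finset.range (r + 1), S.prior ρ t * S.likelihood t k h := rfl
  have e4 : S.nextEarly k s z.1 z.2 (S.early ρ k h) (S.late ρ k h) =
    S.early ρ k h * S.deliveryDensity r s z.1 z.2 +
      S.onset (r' - r) * S.late ρ k h * S.deliveryDensity r' s z.1 z.2 := rfl
  rw [e1, sum_range_add_of_le hr, e4]
  congr 1
  · rw [e3, Finset.sum_mul]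
    refine Finset.sum_congr rfl fun t ht => ?_
    rw [Finset.mem_range] at ht
    rw [S.deliveryDensity_congr (t := t) (t' := r) fun i b hb => by
      have := hd i b hb
      omega]
    ring
  · rw [e2]
    calc _ = ∑ l ∈ Finset.range (r' - r), S.prior ρ (r + 1 + l) * (S.likelihood (r + 1) k h *
          S.deliveryDensity r' s z.1 z.2) := by
          refine Finset.sum_congr rfl fun l hl => ?_
          rw [Finset.mem_range] at hl
          rw [S.deliveryDensity_congr (t := r + 1 + l) (t' := r') fun i b hb => by
              have := hd i b hb
              omega,
            S.likelihood_congr hh (t := r + 1 + l) (t' := r + 1)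
              (show r < _ by omega) (show r < _ by omega)]
      _ = _ := by
          rw [← Finset.sum_mul, S.sum_prior hρ]
          ring

/-- Integration of a cost one slot ahead. -/
theorem setLIntegral_next (hρ : ρ ≤ 1) {V : ℕ → NetState N → ℝ≥0∞ → ℝ≥0∞ → ℝ≥0∞}
    (hV : ∀ k s, Measurable fun x : ℝ≥0∞ × ℝ≥0∞ => V k s x.1 x.2) (k : ℕ)
    {G : Set (Hist N 𝒳 k)} (hG : MeasurableSet G) :
    ∫⁻ h in (Prod.fst ⁻¹' G : Set (Hist N 𝒳 k × SlotObs N 𝒳)),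
        V (k + 1) (histState S.m (k + 1) h) (S.early ρ (k + 1) h) (S.late ρ (k + 1) h)
          ∂S.refLaw N (k + 1) =
      ∫⁻ h in G, S.expectNext V k (histState S.m k h) (S.early ρ k h) (S.late ρ k h)
        ∂S.refLaw N k := by
  have hm : ∀ k, Measurable fun h : Hist N 𝒳 k =>
      V k (histState S.m k h) (S.early ρ k h) (S.late ρ k h) := fun k =>
    S.measurable_of_forall_state (f := fun s h => V k s (S.early ρ k h) (S.late ρ k h)) fun s =>
      (hV k s).comp ((S.measurable_early k).prodMk (S.measurable_late k))
  have hG' : MeasurableSet (Prod.fst ⁻¹' G : Set (Hist N 𝒳 k × SlotObs N 𝒳)) := measurable_fst hG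
  rw [← lintegral_indicator hG', S.lintegral_refLaw_succ k ((hm (k + 1)).indicator hG'),
    ← lintegral_indicator hG]
  refine lintegral_congr_ae ?_
  filter_upwards [S.ae_plausible k] with h hh
  by_cases hGh : h ∈ G
  · rw [Set.indicator_of_mem hGh]
    refine Finset.sum_congr rfl fun o _ => ?_
    -- Outcomes of probability zero are removed first, because the recursion for the early weight
    -- holds only for possible outcomes.
    by_cases ho : S.outcomeWeight (histState S.m k h) o = 0
    · rw [ho, zero_mul, zero_mul]
    congr 1
    refine lintegral_congr fun y => ?_
    rw [Set.indicator_of_mem (show (h, (o, y)) ∈ Prod.fst ⁻¹' G from hGh),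
      S.early_succ hρ hh (S.possible_of_outcomeWeight_ne_zero ho), S.late_succ hρ hh]
    rfl
  · rw [Set.indicator_of_notMem hGh]
    refine Finset.sum_eq_zero fun o _ => ?_
    have : ∀ y, (Prod.fst ⁻¹' G : Set (Hist N 𝒳 k × SlotObs N 𝒳)).indicator (fun h =>
      V (k + 1) (histState S.m (k + 1) h) (S.early ρ (k + 1) h) (S.late ρ (k + 1) h))
        (h, (o, y)) = 0 := fun y => Set.indicator_of_notMem (by simpa using hGh) _
    simp only [this, lintegral_zero, mul_zero]

end Setting

end NADM

namespace NADM

/-! ### Paths and rectangles -/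

section Paths

variable {𝒳 : Type*} {N : ℕ}

/-- The slot outcomes in the history are `o 0, o 1, …`. -/
def OnPath (o : ℕ → Fin (N + 1)) : ∀ k, Hist N 𝒳 k → Prop
  | 0 => fun _ => True
  | k + 1 => fun h => OnPath o k h.1 ∧ h.2.1 = o k

theorem OnPath.histState_eq {o : ℕ → Fin (N + 1)} (m : ℕ) {k : ℕ} {h : Hist N 𝒳 k}
    (hh : OnPath o k h) : histState m k h = netState m o k := by
  induction k with
  | zero => rfl
  | succ k ih => simp only [histState, netState, ih hh.1, hh.2]

theorem OnPath.congr {o o' : ℕ → Fin (N + 1)} {k : ℕ} {h : Hist N 𝒳 k}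
    (hh : OnPath o k h) (ho : ∀ l < k, o l = o' l) : OnPath o' k h := by
  induction k with
  | zero => trivial
  | succ k ih => exact ⟨ih hh.1 fun l hl => ho l (by omega), hh.2.trans (ho k (by omega))⟩

theorem OnPath.unique {o o' : ℕ → Fin (N + 1)} {k : ℕ} {h : Hist N 𝒳 k}
    (hh : OnPath o k h) (hh' : OnPath o' k h) : ∀ l < k, o l = o' l := by
  induction k with
  | zero => intro l hl; omega
  | succ k ih =>
    intro l hl
    rcases Nat.lt_succ_iff_lt_or_eq.1 hl with h1 | rfl
    · exact ih hh.1 hh'.1 l h1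
    · exact hh.2.symm.trans hh'.2

theorem exists_onPath (k : ℕ) (h : Hist N 𝒳 k) : ∃ o : ℕ → Fin (N + 1), OnPath o k h := by
  induction k with
  | zero => exact ⟨fun _ => 0, trivial⟩
  | succ k ih =>
    obtain ⟨o, ho⟩ := ih h.1
    refine ⟨Function.update o k h.2.1, ho.congr fun l hl => ?_, ?_⟩
    · rw [Function.update_of_ne (by omega)]
    · rw [Function.update_self]

theorem measurableSet_onPath [MeasurableSpace 𝒳] (o : ℕ → Fin (N + 1)) (k : ℕ) :
    MeasurableSet {h : Hist N 𝒳 k | OnPath o k h} := by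
  induction k with
  | zero => exact MeasurableSet.univ
  | succ k ih =>
    exact (measurable_fst ih).inter
      ((measurable_fst.comp measurable_snd) (measurableSet_singleton (o k)))

/-- The finitely many outcome prefixes of length `k`, padded by 0 to infinite paths, partition the
histories. -/
theorem measure_eq_of_forall_onPath [MeasurableSpace 𝒳] {k : ℕ} {ν ν' : Measure (Hist N 𝒳 k)}
    {G : Set (Hist N 𝒳 k)} (hG : MeasurableSet G)
    (h : ∀ o, ν (G ∩ {h | OnPath o k h}) = ν' (G ∩ {h | OnPath o k h})) : ν G = ν' G := by
  let e : (Fin k → Fin (N + 1)) → ℕ → Fin (N + 1) := fun f l => if hl : l < k then f ⟨l, hl⟩ else 0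
  have hU : G = ⋃ f, G ∩ {h | OnPath (e f) k h} := by
    rw [← Set.inter_iUnion, eq_comm, Set.inter_eq_left]
    intro x _
    obtain ⟨o, ho⟩ := exists_onPath k x
    refine Set.mem_iUnion.2 ⟨fun l => o l, ho.congr fun l hl => ?_⟩
    simp only [e, dif_pos hl]
  have hdisj : Pairwise (Function.onFun Disjoint fun f => G ∩ {h | OnPath (e f) k h}) := by
    intro f f' hff
    refine Set.disjoint_left.2 fun x hx hx' => hff (funext fun l => ?_)
    have := OnPath.unique hx.2 hx'.2 l l.2
    simpa only [e, dif_pos l.2] using this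
  have hmeas : ∀ f, MeasurableSet (G ∩ {h | OnPath (e f) k h}) := fun f =>
    hG.inter (measurableSet_onPath _ k)
  rw [hU, measure_iUnion hdisj hmeas, measure_iUnion hdisj hmeas]
  exact tsum_congr fun f => h _

/-- Rectangles of histories. -/
def rectangles (N : ℕ) (𝒳 : Type*) [MeasurableSpace 𝒳] : ∀ k, Set (Set (Hist N 𝒳 k))
  | 0 => {Set.univ}
  | k + 1 => Set.image2 (· ×ˢ ·) (rectangles N 𝒳 k)
      (Set.image2 (· ×ˢ ·) {O : Set (Fin (N + 1)) | MeasurableSet O}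
        (Set.pi Set.univ '' Set.pi Set.univ fun _ : Fin N => {C : Set (𝒳 ⊕ Unit) | MeasurableSet C}))

theorem univ_mem_slot_rectangles [MeasurableSpace 𝒳] :
    Set.univ ∈ Set.pi Set.univ '' Set.pi Set.univ
      fun _ : Fin N => {C : Set (𝒳 ⊕ Unit) | MeasurableSet C} :=
  ⟨fun _ => Set.univ, by simp, Set.pi_univ _⟩

theorem univ_mem_rectangles [MeasurableSpace 𝒳] (k : ℕ) : Set.univ ∈ rectangles N 𝒳 k := by
  induction k with
  | zero => rfl
  | succ k ih =>
    exact ⟨Set.univ, ih, Set.univ, ⟨Set.univ, by simp, Set.univ, univ_mem_slot_rectangles,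
      Set.univ_prod_univ⟩,
      Set.univ_prod_univ⟩

theorem isPiSystem_rectangles [MeasurableSpace 𝒳] (k : ℕ) : IsPiSystem (rectangles N 𝒳 k) := by
  induction k with
  | zero => exact IsPiSystem.singleton _
  | succ k ih => exact ih.prod (MeasurableSpace.isPiSystem_measurableSet.prod isPiSystem_pi)

theorem isCountablySpanning_of_univ_mem {α : Type*} {C : Set (Set α)} (h : Set.univ ∈ C) :
    IsCountablySpanning C :=
  ⟨fun _ => Set.univ, fun _ => h, Set.iUnion_const _⟩

theorem generateFrom_rectangles [MeasurableSpace 𝒳] (k : ℕ) :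
    instMeasurableSpaceHist N 𝒳 k = MeasurableSpace.generateFrom (rectangles N 𝒳 k) := by
  induction k with
  | zero =>
    refine le_antisymm (fun s _ => ?_) le_top
    rcases Set.eq_empty_or_nonempty s with rfl | ⟨⟨⟩, hx⟩
    · exact @MeasurableSet.empty _ (MeasurableSpace.generateFrom _)
    · have : s = Set.univ := Set.eq_univ_of_forall fun ⟨⟩ => hx
      rw [this]
      exact @MeasurableSet.univ _ (MeasurableSpace.generateFrom _)
  | succ k ih =>
    have h1 : MeasurableSpace.generateFrom (Set.image2 (· ×ˢ ·) {O : Set (Fin (N + 1)) |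
        MeasurableSet O} (Set.pi Set.univ '' Set.pi Set.univ fun _ : Fin N =>
          {C : Set (𝒳 ⊕ Unit) | MeasurableSet C})) =
        (inferInstance : MeasurableSpace (SlotObs N 𝒳)) := by
      refine generateFrom_eq_prod MeasurableSpace.generateFrom_measurableSet generateFrom_pi
        (isCountablySpanning_of_univ_mem (by simp))
        (isCountablySpanning_of_univ_mem univ_mem_slot_rectangles)
    refine (generateFrom_eq_prod ih.symm h1
      (isCountablySpanning_of_univ_mem (univ_mem_rectangles k))
      (isCountablySpanning_of_univ_mem ?_)).symm
    exact ⟨Set.univ, by simp, Set.univ, univ_mem_slot_rectangles, Set.univ_prod_univ⟩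

/-! ### Histories as functions of outcomes and samples -/

/-- The samples handed over in configuration `s` with slot outcome `o`. -/
noncomputable def handedOver (s : NetState N) (o : Fin (N + 1)) (x : ℕ → Fin N → 𝒳) :
    Fin N → 𝒳 ⊕ Unit :=
  fun i => match delivered s o i with
    | none => Sum.inr ()
    | some b => Sum.inl (x b i)

/-- The history with slot outcomes `o` and samples `x`. -/
noncomputable def history (m : ℕ) (o : ℕ → Fin (N + 1)) (x : ℕ → Fin N → 𝒳) :
    ∀ k, Hist N 𝒳 k
  | 0 => PUnit.unit
  | k + 1 => (history m o x k, (o k, handedOver (netState m o k) (o k) x))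

theorem history_congr {m : ℕ} {o o' : ℕ → Fin (N + 1)} {x : ℕ → Fin N → 𝒳} {k : ℕ}
    (h : ∀ l < k, o l = o' l) : history m o x k = history m o' x k := by
  induction k with
  | zero => rfl
  | succ k ih =>
    simp only [history]
    rw [ih fun l hl => h l (by omega), h k (by omega),
      netState_congr (o := o) (o' := o') fun l hl => h l (by omega)]

theorem onPath_history (m : ℕ) (o : ℕ → Fin (N + 1)) (x : ℕ → Fin N → 𝒳) (k : ℕ) :
    OnPath o k (history m o x k) := by
  induction k with
  | zero => trivial
  | succ k ih => exact ⟨ih, rfl⟩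

end Paths

namespace Setting

variable {𝒳 : Type*} [MeasurableSpace 𝒳] (S : Setting 𝒳) {N : ℕ}

/-- A single entry constrains at most one batch; trivial factors of mass one bring its law into the
form of a box over all batches. -/
theorem entryProb_eq_prod {t n : ℕ} {d : Option ℕ} {C : Set (𝒳 ⊕ Unit)}
    (hd : ∀ b, d = some b → b ∈ Finset.Icc 1 n) (hC : d = none → Sum.inr () ∈ C) :
    S.entryProb t d C = ∏ b ∈ Finset.Icc 1 n,
      S.sampleLaw t b (if d = some b then Sum.inl ⁻¹' C else Set.univ) := by
  cases d with
  | none => simp [entryProb, hC rfl]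
  | some b =>
    rw [Finset.prod_eq_single_of_mem b (hd b rfl)]
    · simp [entryProb]
    · intro b' _ hb'
      rw [if_neg (by simpa using hb'.symm), measure_univ]

/-- On a path, a rectangle of histories is a box of samples. -/
theorem exists_box_of_mem_rectangles (o : ℕ → Fin (N + 1)) (k : ℕ) {G : Set (Hist N 𝒳 k)}
    (hG : G ∈ rectangles N 𝒳 k) :
    ∃ (q : Prop) (E : ℕ → Fin N → Set 𝒳), MeasurableSet G ∧ (∀ b i, MeasurableSet (E b i)) ∧
      (∀ b i, ¬ Received (netState S.m o k) b i → E b i = Set.univ) ∧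
      (∀ x, history S.m o x k ∈ G ↔ q ∧ ∀ b i, x b i ∈ E b i) ∧
      -- The bound `n` is left free so that the induction hypothesis applies with the bound of the
      -- later slot.
      ∀ t n, (netState S.m o k).B ≤ n →
        (q → ∫⁻ h in G ∩ {h | OnPath o k h}, S.likelihood t k h ∂S.refLaw N k =
          (∏ l ∈ Finset.range k, S.outcomeWeight (netState S.m o l) (o l)) *
            ∏ b ∈ Finset.Icc 1 n, ∏ i, S.sampleLaw t b (E b i)) ∧
        (¬ q → ∫⁻ h in G ∩ {h | OnPath o k h}, S.likelihood t k h ∂S.refLaw N k = 0) := by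
  induction k with
  | zero =>
    obtain rfl : G = Set.univ := hG
    refine ⟨True, fun _ _ => Set.univ, MeasurableSet.univ, fun _ _ => MeasurableSet.univ,
      fun _ _ _ => rfl, fun x => by simp, fun t n _ => ⟨fun _ => ?_, fun h => absurd trivial h⟩⟩
    have : (Set.univ ∩ {h | OnPath o 0 h} : Set (Hist N 𝒳 0)) = Set.univ := by
      simp [OnPath]
    rw [this, setLIntegral_univ]
    simp only [likelihood, lintegral_one, Finset.range_zero, Finset.prod_empty, measure_univ,
      Finset.prod_const_one, mul_one]
    exact (S.isProbabilityMeasure_refLaw (N := N) 0).measure_univ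
  | succ k ih =>
    obtain ⟨G₁, hG₁, _, ⟨O, hO, _, ⟨C, hC, rfl⟩, rfl⟩, rfl⟩ := hG
    replace hC : ∀ i, MeasurableSet (C i) := fun i => hC i (Set.mem_univ i)
    obtain ⟨q, E, hGm, hEm, hE, hmem, hint⟩ := ih hG₁
    set s := netState S.m o k with hs
    have hB : ∀ i b, delivered s (o k) i = some b → Received (netState S.m o (k + 1)) b i :=
      fun i b hb => received_of_delivered (netState_B_pos S.m o k) hb
    have hrec : ∀ b i, Received s b i → Received (netState S.m o (k + 1)) b i :=
      fun b i hb => hb.netStep (o k)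
    classical
    -- `D` collects the constraints on the samples handed over in slot `k`; constraints on the
    -- outcome and on empty entries do not depend on the samples and go into the proposition `q`.
    let D : ℕ → Fin N → Set 𝒳 := fun b i =>
      if delivered s (o k) i = some b then Sum.inl ⁻¹' C i else Set.univ
    have hDm : ∀ b i, MeasurableSet (D b i) := fun b i => by
      simp only [D]
      split_ifs
      · exact measurable_inl (hC i)
      · exact MeasurableSet.univ
    have hmeas : MeasurableSet (G₁ ×ˢ (O ×ˢ Set.pi Set.univ C) : Set (Hist N 𝒳 k × SlotObs N 𝒳)) :=
      hGm.prod (MeasurableSet.prod hO (MeasurableSet.univ_pi hC))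
    refine ⟨q ∧ o k ∈ O ∧ ∀ i, delivered s (o k) i = none → Sum.inr () ∈ C i,
      fun b i => E b i ∩ D b i, hmeas, fun b i => (hEm b i).inter (hDm b i), fun b i hb => ?_,
      fun x => ?_, fun t n hn => ?_⟩
    · have h1 : E b i = Set.univ := hE b i fun h => hb (hrec b i h)
      have h2 : D b i = Set.univ := if_neg fun h => hb (hB i b h)
      simp only [h1, h2, Set.univ_inter]
    · have h1 : handedOver s (o k) x ∈ Set.pi Set.univ C ↔
          (∀ i, delivered s (o k) i = none → Sum.inr () ∈ C i) ∧ ∀ b i, x b i ∈ D b i := by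
        simp only [Set.mem_univ_pi, handedOver]
        constructor
        · intro h
          refine ⟨fun i hi => by simpa [hi] using h i, fun b i => ?_⟩
          simp only [D]
          split_ifs with hd
          · simpa [hd] using h i
          · trivial
        · rintro ⟨h1, h2⟩ i
          cases hd : delivered s (o k) i with
          | none => exact h1 i hd
          | some b =>
            have := h2 b i
            simpa only [D, if_pos hd, Set.mem_preimage] using this
      have h2 : history S.m o x (k + 1) ∈ (G₁ ×ˢ (O ×ˢ Set.pi Set.univ C) :
          Set (Hist N 𝒳 k × SlotObs N 𝒳)) ↔ history S.m o x k ∈ G₁ ∧ o k ∈ O ∧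
            handedOver s (o k) x ∈ Set.pi Set.univ C := Iff.rfl
      rw [h2, h1, hmem]
      simp only [Set.mem_inter_iff]
      grind
    · have hBle : s.B ≤ (netState S.m o (k + 1)).B := by
        change s.B ≤ (netStep S.m k s (o k)).B
        simp only [netStep]
        split_ifs <;> omega
      have hstep : ∫⁻ h in (G₁ ×ˢ (O ×ˢ Set.pi Set.univ C) ∩ {h | OnPath o (k + 1) h} :
            Set (Hist N 𝒳 k × SlotObs N 𝒳)), S.likelihood t (k + 1) h ∂S.refLaw N (k + 1) =
          (∫⁻ h in G₁ ∩ {h | OnPath o k h}, S.likelihood t k h ∂S.refLaw N k) *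
            (S.outcomeWeight s (o k) * ((if o k ∈ O then 1 else 0) *
              ∏ i, S.entryProb t (delivered s (o k) i) (C i))) := by
        have hm1 : MeasurableSet (G₁ ×ˢ (O ×ˢ Set.pi Set.univ C) ∩ {h | OnPath o (k + 1) h} :
            Set (Hist N 𝒳 k × SlotObs N 𝒳)) := hmeas.inter (measurableSet_onPath o (k + 1))
        have hm2 : MeasurableSet (G₁ ∩ {h : Hist N 𝒳 k | OnPath o k h}) :=
          hGm.inter (measurableSet_onPath o k)
        rw [← lintegral_indicator hm1, S.lintegral_refLaw_succ k
          ((S.measurable_likelihood t (k + 1)).indicator hm1),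
          ← lintegral_mul_const _ (S.measurable_likelihood t k), ← lintegral_indicator hm2]
        refine lintegral_congr fun h => ?_
        by_cases hh : h ∈ G₁ ∩ {h : Hist N 𝒳 k | OnPath o k h}
        · have hst : histState S.m k h = s := hh.2.histState_eq S.m
          rw [Set.indicator_of_mem hh, Finset.sum_eq_single (o k)]
          · rw [hst, ← S.setLIntegral_deliveryDensity t s (o k) hC,
              ← lintegral_indicator (MeasurableSet.univ_pi hC)]
            have hpt : ∀ y, (G₁ ×ˢ (O ×ˢ Set.pi Set.univ C) ∩ {h | OnPath o (k + 1) h} :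
                Set (Hist N 𝒳 k × SlotObs N 𝒳)).indicator (S.likelihood t (k + 1)) (h, (o k, y)) =
                (S.likelihood t k h * if o k ∈ O then 1 else 0) *
                  (Set.pi Set.univ C).indicator (S.deliveryDensity t s (o k)) y := by
              intro y
              by_cases hOk : o k ∈ O
              · by_cases hy : y ∈ Set.pi Set.univ C
                · have hmem : (h, (o k, y)) ∈ (G₁ ×ˢ (O ×ˢ Set.pi Set.univ C) ∩
                      {h | OnPath o (k + 1) h} : Set (Hist N 𝒳 k × SlotObs N 𝒳)) :=
                    ⟨⟨hh.1, hOk, hy⟩, hh.2, rfl⟩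
                  rw [Set.indicator_of_mem hmem, Set.indicator_of_mem hy,
                    if_pos hOk, mul_one]
                  simp only [likelihood, hst]
                · rw [Set.indicator_of_notMem fun h' => hy h'.1.2.2, Set.indicator_of_notMem hy,
                    mul_zero]
              · rw [Set.indicator_of_notMem fun h' => hOk h'.1.2.1, if_neg hOk, mul_zero, zero_mul]
            simp only [hpt]
            rw [lintegral_const_mul _
              ((S.measurable_deliveryDensity t s (o k)).indicator (MeasurableSet.univ_pi hC))]
            ring
          · intro o' _ ho'
            have : ∀ y, (G₁ ×ˢ (O ×ˢ Set.pi Set.univ C) ∩ {h | OnPath o (k + 1) h} :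
                Set (Hist N 𝒳 k × SlotObs N 𝒳)).indicator (S.likelihood t (k + 1)) (h, (o', y)) =
                0 := fun y => Set.indicator_of_notMem (fun h' => ho' h'.2.2) _
            simp only [this, lintegral_zero, mul_zero]
          · intro h'
            exact absurd (Finset.mem_univ _) h'
        · rw [Set.indicator_of_notMem hh]
          refine Finset.sum_eq_zero fun o' _ => ?_
          have : ∀ y, (G₁ ×ˢ (O ×ˢ Set.pi Set.univ C) ∩ {h | OnPath o (k + 1) h} :
              Set (Hist N 𝒳 k × SlotObs N 𝒳)).indicator (S.likelihood t (k + 1)) (h, (o', y)) =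
              0 := fun y => Set.indicator_of_notMem (fun h' => hh ⟨h'.1.1, h'.2.1⟩) _
          simp only [this, lintegral_zero, mul_zero]
      refine ⟨fun hq => ?_, fun hq => ?_⟩
      · obtain ⟨hq, hOk, hCn⟩ := hq
        refine hstep.trans ?_
        rw [(hint t n (hBle.trans hn)).1 hq, if_pos hOk, one_mul, Finset.prod_range_succ]
        have h1 : ∏ i, S.entryProb t (delivered s (o k) i) (C i) =
            ∏ b ∈ Finset.Icc 1 n, ∏ i, S.sampleLaw t b (D b i) := by
          rw [Finset.prod_comm]
          refine Finset.prod_congr rfl fun i _ => ?_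
          refine S.entryProb_eq_prod (fun b hb => ?_) (hCn i)
          have := hB i b hb
          rw [Finset.mem_Icc]
          refine ⟨this.1, ?_⟩
          have := this.2
          omega
        -- A sample handed over now was not received earlier, so in each coordinate `E b i` or `D b
        -- i` is the whole space and the mass of the intersection factors.
        have h2 : ∏ b ∈ Finset.Icc 1 n, ∏ i, S.sampleLaw t b (E b i ∩ D b i) =
            (∏ b ∈ Finset.Icc 1 n, ∏ i, S.sampleLaw t b (E b i)) *
              ∏ b ∈ Finset.Icc 1 n, ∏ i, S.sampleLaw t b (D b i) := by
          simp only [← Finset.prod_mul_distrib]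
          refine Finset.prod_congr rfl fun b _ => Finset.prod_congr rfl fun i _ => ?_
          by_cases hd : delivered s (o k) i = some b
          · rw [hE b i (not_received_of_delivered hd)]
            simp
          · have : D b i = Set.univ := if_neg hd
            rw [this]
            simp
        rw [h1, h2]
        ring
      · refine hstep.trans ?_
        by_cases hq' : q
        · by_cases hOk : o k ∈ O
          · have : ∃ i, delivered s (o k) i = none ∧ Sum.inr () ∉ C i := by
              by_contra hcon
              push Not at hcon
              exact hq ⟨hq', hOk, hcon⟩
            obtain ⟨i, hi, hCi⟩ := this
            have : ∏ i, S.entryProb t (delivered s (o k) i) (C i) = 0 :=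
              Finset.prod_eq_zero (Finset.mem_univ i) (by simp [hi, entryProb, hCi])
            rw [this, mul_zero, mul_zero, mul_zero]
          · rw [if_neg hOk, zero_mul, mul_zero, mul_zero]
        · rw [(hint t n (hBle.trans hn)).2 hq', zero_mul]

end Setting

end NADM

namespace NADM

/-! ### The observed history -/

section Observe

variable {Ω 𝒳 : Type*} [MeasurableSpace Ω] [MeasurableSpace 𝒳] {N : ℕ}

instance : DiscreteMeasurableSpace (QueueState N) := ⟨fun _ => trivial⟩

instance : Countable (QueueState N) :=
  Function.Injective.countable (f := fun q : QueueState N => (q.lam, q.B, q.Δ, q.W, q.R)) (by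
    intro s t h
    simp only [Prod.mk.injEq] at h
    exact QueueState.ext h.1 h.2.1 h.2.2.1 h.2.2.2.1 h.2.2.2.2)

/-- The history observed up to time `k`. -/
noncomputable def observe (m : ℕ) (M : ℕ → Ω → Fin (N + 1)) (X : ℕ → Fin N → Ω → 𝒳) (k : ℕ)
    (ω : Ω) : Hist N 𝒳 k :=
  history m (fun l => M l ω) (fun b i => X b i ω) k

variable {m : ℕ} {M : ℕ → Ω → Fin (N + 1)} {X : ℕ → Fin N → Ω → 𝒳}

omit [MeasurableSpace Ω] [MeasurableSpace 𝒳] in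
theorem histState_observe (k : ℕ) (ω : Ω) :
    histState m k (observe m M X k ω) = netState m (fun l => M l ω) k :=
  (onPath_history m _ _ k).histState_eq m

omit [MeasurableSpace Ω] [MeasurableSpace 𝒳] in
theorem Q_eq_observedState (k : ℕ) (ω : Ω) :
    Q m M k ω = observedState m k (histState m k (observe m M X k ω)) := by
  rw [histState_observe]
  rfl

theorem measurable_observe (hM : ∀ k, Measurable (M k)) (hX : ∀ b i, Measurable (X b i)) (k : ℕ) :
    Measurable (observe m M X k) := by
  induction k with
  | zero => exact measurable_const
  | succ k ih => exact ih.prodMk ((hM k).prodMk (measurable_snd.comp (measurable_Z hM hX (k + 1))))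

theorem information_le_comap_observe (hM : ∀ k, Measurable (M k)) (hX : ∀ b i, Measurable (X b i))
    (k : ℕ) : information (m := m) hM hX k ≤
      MeasurableSpace.comap (observe m M X k) inferInstance := by
  have hmono : ∀ l k, l ≤ k → MeasurableSpace.comap (observe m M X l) inferInstance ≤
      MeasurableSpace.comap (observe m M X k) inferInstance := by
    intro l k hlk
    induction k, hlk using Nat.le_induction with
    | base => exact le_rfl
    | succ k _ ih =>
      refine ih.trans ?_
      rintro _ ⟨A, hA, rfl⟩
      exact ⟨Prod.fst ⁻¹' A, measurable_fst hA, rfl⟩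
  refine iSup₂_le fun l hl => le_trans ?_ (hmono l k hl)
  rintro _ ⟨A, hA, rfl⟩
  cases l with
  -- The observation at time 0 is constant, so any path may be used to write it down.
  | zero => exact MeasurableSet.const ((queueState m (fun _ => (0 : Fin (N + 1))) 0,
      fun _ => (Sum.inr () : 𝒳 ⊕ Unit)) ∈ A)
  | succ l =>
    have hg : Measurable fun h : Hist N 𝒳 (l + 1) =>
        (observedState m (l + 1) (histState m (l + 1) h), h.2.2) :=
      ((measurable_of_countable (observedState m (l + 1))).comp
        (measurable_histState m (l + 1))).prodMk (measurable_snd.comp measurable_snd)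
    refine ⟨_, hg hA, ?_⟩
    ext ω
    have hQ := Q_eq_observedState (m := m) (M := M) (X := X) (l + 1) ω
    simp only [Set.mem_preimage, Z]
    rw [hQ]
    rfl

theorem measurable_Z_information (hM : ∀ k, Measurable (M k)) (hX : ∀ b i, Measurable (X b i))
    (k : ℕ) : Measurable[information (m := m) hM hX k] (Z m M X k) :=
  (comap_measurable (Z m M X k)).mono
    (le_iSup₂ (f := fun l (_ : l ≤ k) => MeasurableSpace.comap (Z m M X l) inferInstance) k le_rfl)
    le_rfl

/-- By induction the past configuration is known, and comparing it with the next observed state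
reveals the slot outcome; hence the whole history, hidden queues included, is known to the decision
maker. -/
theorem measurable_observe_information (hM : ∀ k, Measurable (M k))
    (hX : ∀ b i, Measurable (X b i)) (k : ℕ) :
    Measurable[information (m := m) hM hX k] (observe m M X k) := by
  induction k with
  | zero => exact measurable_const
  | succ k ih =>
    have h1 : Measurable[information (m := m) hM hX (k + 1)] (observe m M X k) :=
      ih.mono ((information hM hX).mono (Nat.le_succ k)) le_rfl
    have h2 := measurable_Z_information (m := m) hM hX (k + 1)
    refine Measurable.prodMk h1 (Measurable.prodMk ?_ (measurable_snd.comp h2))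
    refine @measurable_to_countable' _ _ _ _ (information (m := m) hM hX (k + 1)) _ fun o => ?_
    have h3 : Measurable[information (m := m) hM hX (k + 1)]
        fun ω => (histState m k (observe m M X k ω), (Z m M X (k + 1) ω).1) :=
      Measurable.prodMk ((measurable_histState m k).comp h1) (measurable_fst.comp h2)
    have h4 : (M k) ⁻¹' {o} = (fun ω => (histState m k (observe m M X k ω),
        (Z m M X (k + 1) ω).1)) ⁻¹' {x : NetState N × QueueState N |
          x.2.B = (netStep m k x.1 o).B ∧ x.2.W = (netStep m k x.1 o).W ∧
            x.2.R = (netStep m k x.1 o).R} := by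
      ext ω
      simp only [Set.mem_preimage, Set.mem_singleton_iff, Set.mem_ofPred_eq, histState_observe, Z, Q,
        queueState, netState]
      constructor
      · intro h
        simp only [h, and_self]
      · rintro ⟨h1, h2, h3⟩
        exact netStep_observable_injective h1 h2 h3
    rw [h4]
    exact h3 (Set.to_countable _).measurableSet

theorem information_eq_comap_observe (hM : ∀ k, Measurable (M k))
    (hX : ∀ b i, Measurable (X b i)) (k : ℕ) : information (m := m) hM hX k =
      MeasurableSpace.comap (observe m M X k) inferInstance :=
  le_antisymm (information_le_comap_observe hM hX k)
    (measurable_observe_information hM hX k).comap_le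

end Observe

/-! ### The law of the history -/

namespace Setting

variable {Ω 𝒳 : Type*} [MeasurableSpace Ω] [MeasurableSpace 𝒳] {S : Setting 𝒳} {N : ℕ} {ρ : ℝ}
  {μ : Measure Ω} [IsProbabilityMeasure μ] {T : Ω → ℕ} {M : ℕ → Ω → Fin (N + 1)}
  {X : ℕ → Fin N → Ω → 𝒳}

theorem measure_path (h : IsModel S.m S.σ S.p ρ S.F₀ S.F₁ μ T M X) (o : ℕ → Fin (N + 1)) (k : ℕ) :
    μ {ω | ∀ l, l < k → M l ω = o l} =
      ∏ l ∈ Finset.range k, S.outcomeWeight (netState S.m o l) (o l) := by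
  induction k with
  | zero => simp
  | succ k ih =>
    rw [Finset.prod_range_succ, ← ih, outcomeWeight, ← ofReal_measureReal, h.law_M k o,
      ENNReal.ofReal_mul measureReal_nonneg, ofReal_measureReal]

theorem measure_changeTime (h : IsModel S.m S.σ S.p ρ S.F₀ S.F₁ μ T M X) (t : ℕ) :
    μ {ω | T ω = t} = S.prior ρ t := by
  rw [← ofReal_measureReal, prior]
  congr 1
  split_ifs with ht
  · rw [ht, h.law_T_zero]
  · exact h.law_T_pos t (by omega)

theorem measure_box (h : IsModel S.m S.σ S.p ρ S.F₀ S.F₁ μ T M X) (t n : ℕ)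
    {E : ℕ → Fin N → Set 𝒳} (hE : ∀ b i, MeasurableSet (E b i))  :
    μ {ω | T ω = t ∧ ∀ b ∈ Finset.Icc 1 n, ∀ i, X b i ω ∈ E b i} =
      S.prior ρ t * ∏ b ∈ Finset.Icc 1 n, ∏ i, S.sampleLaw t b (E b i) := by
  rw [← ofReal_measureReal, h.law_X t n E hE, ENNReal.ofReal_mul measureReal_nonneg,
    ofReal_measureReal, measure_changeTime h]
  congr 1
  rw [ENNReal.ofReal_prod_of_nonneg fun b _ => Finset.prod_nonneg fun i _ => measureReal_nonneg]
  refine Finset.prod_congr rfl fun b _ => ?_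
  rw [ENNReal.ofReal_prod_of_nonneg fun i _ => measureReal_nonneg]
  refine Finset.prod_congr rfl fun i _ => ?_
  exact ofReal_measureReal (μ := S.sampleLaw t b)

theorem measure_path_box (h : IsModel S.m S.σ S.p ρ S.F₀ S.F₁ μ T M X) (o : ℕ → Fin (N + 1))
    (k t n : ℕ) {E : ℕ → Fin N → Set 𝒳} (hE : ∀ b i, MeasurableSet (E b i)) :
    μ ({ω | ∀ l, l < k → M l ω = o l} ∩
        {ω | T ω = t ∧ ∀ b ∈ Finset.Icc 1 n, ∀ i, X b i ω ∈ E b i}) =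
      (∏ l ∈ Finset.range k, S.outcomeWeight (netState S.m o l) (o l)) *
        (S.prior ρ t * ∏ b ∈ Finset.Icc 1 n, ∏ i, S.sampleLaw t b (E b i)) := by
  rw [← measure_path h, ← measure_box h t n hE]
  have h1 : MeasurableSet {f : ℕ → Fin (N + 1) | ∀ l, l < k → f l = o l} := by
    have : {f : ℕ → Fin (N + 1) | ∀ l, l < k → f l = o l} =
        ⋂ l, ⋂ (_ : l < k), (fun f => f l) ⁻¹' {o l} := by
      ext f
      simp
    rw [this]
    exact MeasurableSet.iInter fun l => MeasurableSet.iInter fun _ =>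
      measurable_pi_apply l (measurableSet_singleton _)
  -- In the independence hypothesis, batch `b` is the coordinate `b - 1`.
  have h2 : MeasurableSet {f : ℕ × (ℕ → Fin N → 𝒳) | f.1 = t ∧ ∀ b ∈ Finset.Icc 1 n, ∀ i,
      f.2 (b - 1) i ∈ E b i} := by
    have : {f : ℕ × (ℕ → Fin N → 𝒳) | f.1 = t ∧ ∀ b ∈ Finset.Icc 1 n, ∀ i, f.2 (b - 1) i ∈ E b i} =
        Prod.fst ⁻¹' {t} ∩ ⋂ b, ⋂ (_ : b ∈ Finset.Icc 1 n), ⋂ i,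
          (fun f : ℕ × (ℕ → Fin N → 𝒳) => f.2 (b - 1) i) ⁻¹' E b i := by
      ext f
      simp
    rw [this]
    refine (measurable_fst (measurableSet_singleton t)).inter ?_
    refine MeasurableSet.iInter fun b => MeasurableSet.iInter fun _ => MeasurableSet.iInter fun i => ?_
    have : Measurable fun f : ℕ × (ℕ → Fin N → 𝒳) => f.2 (b - 1) i := by fun_prop
    exact this (hE b i)
  have h3 := h.indep.measure_inter_preimage_eq_mul _ _ h1 h2
  have h4 : (fun ω => (T ω, fun (b : ℕ) (i : Fin N) => X (b + 1) i ω)) ⁻¹'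
      {f : ℕ × (ℕ → Fin N → 𝒳) | f.1 = t ∧ ∀ b ∈ Finset.Icc 1 n, ∀ i, f.2 (b - 1) i ∈ E b i} =
      {ω | T ω = t ∧ ∀ b ∈ Finset.Icc 1 n, ∀ i, X b i ω ∈ E b i} := by
    ext ω
    simp only [Set.mem_preimage, Set.mem_ofPred_eq]
    refine and_congr_right fun _ => forall₂_congr fun b hb => ?_
    rw [Finset.mem_Icc] at hb
    rw [Nat.sub_add_cancel hb.1]
  rw [h4] at h3
  exact h3

/-- The likelihood is the density of the law of the history, given the change time. -/
theorem measure_changeTime_inter_observe (h : IsModel S.m S.σ S.p ρ S.F₀ S.F₁ μ T M X) (t k : ℕ)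
    {G : Set (Hist N 𝒳 k)} (hG : MeasurableSet G) :
    μ ({ω | T ω = t} ∩ observe S.m M X k ⁻¹' G) =
      S.prior ρ t * ∫⁻ h in G, S.likelihood t k h ∂S.refLaw N k := by
  have hobs : Measurable (observe S.m M X k) := measurable_observe h.measurable_M h.measurable_X k
  have hTm : MeasurableSet {ω | T ω = t} := h.measurable_T (measurableSet_singleton t)
  have hν : ∀ {G : Set (Hist N 𝒳 k)}, MeasurableSet G →
      ((μ.restrict {ω | T ω = t}).map (observe S.m M X k)) G =
        μ ({ω | T ω = t} ∩ observe S.m M X k ⁻¹' G) := fun hG => by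
    rw [Measure.map_apply hobs hG, Measure.restrict_apply (hobs hG), Set.inter_comm]
  have hν' : ∀ {G : Set (Hist N 𝒳 k)}, MeasurableSet G →
      (S.prior ρ t • (S.refLaw N k).withDensity (S.likelihood t k)) G =
        S.prior ρ t * ∫⁻ h in G, S.likelihood t k h ∂S.refLaw N k := fun hG => by
    rw [Measure.smul_apply, withDensity_apply _ hG, smul_eq_mul]
  -- It suffices to compare the two finite measures on the π-system of rectangles, path by path;
  -- there a rectangle is an outcome event intersected with a box of samples, and independence
  -- applies.
  have key : ∀ G ∈ rectangles N 𝒳 k, ((μ.restrict {ω | T ω = t}).map (observe S.m M X k)) G =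
      (S.prior ρ t • (S.refLaw N k).withDensity (S.likelihood t k)) G := by
    intro G hGr
    have hGm : MeasurableSet G := by
      obtain ⟨_, _, hGm, _⟩ := S.exists_box_of_mem_rectangles (fun _ => 0) k hGr
      exact hGm
    refine measure_eq_of_forall_onPath hGm fun o => ?_
    have hGo := hGm.inter (measurableSet_onPath o k)
    rw [hν hGo, hν' hGo]
    obtain ⟨q, E, -, hEm, hE, hmem, hint⟩ := S.exists_box_of_mem_rectangles o k hGr
    have hobs_iff : ∀ ω, observe S.m M X k ω ∈ G ∩ {h | OnPath o k h} ↔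
        (∀ l, l < k → M l ω = o l) ∧ q ∧ ∀ b i, X b i ω ∈ E b i := by
      intro ω
      constructor
      · rintro ⟨h1, h2⟩
        have h3 := (onPath_history S.m (fun l => M l ω) (fun b i => X b i ω) k).unique h2
        refine ⟨h3, (hmem _).1 ?_⟩
        rwa [observe, history_congr h3] at h1
      · rintro ⟨h1, h2⟩
        rw [observe, history_congr h1]
        exact ⟨(hmem _).2 h2, onPath_history S.m o _ k⟩
    set n := (netState S.m o k).B with hn
    by_cases hq : q
    · rw [(hint t n le_rfl).1 hq]
      have hset : {ω | T ω = t} ∩ observe S.m M X k ⁻¹' (G ∩ {h | OnPath o k h}) =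
          {ω | ∀ l, l < k → M l ω = o l} ∩
            {ω | T ω = t ∧ ∀ b ∈ Finset.Icc 1 n, ∀ i, X b i ω ∈ E b i} := by
        ext ω
        -- Batches outside the range have not been received and are unconstrained.
        have hbox : (∀ b i, X b i ω ∈ E b i) ↔ ∀ b ∈ Finset.Icc 1 n, ∀ i, X b i ω ∈ E b i := by
          refine ⟨fun h b _ i => h b i, fun h b i => ?_⟩
          by_cases hb : b ∈ Finset.Icc 1 n
          · exact h b hb i
          · rw [hE b i]
            · trivial
            · rintro ⟨h1, h2⟩
              apply hb
              rw [Finset.mem_Icc]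
              omega
        simp only [Set.mem_inter_iff, Set.mem_ofPred_eq, Set.mem_preimage]
        have := hobs_iff ω
        simp only [Set.mem_inter_iff, Set.mem_ofPred_eq] at this
        rw [this, hbox]
        tauto
      rw [hset, measure_path_box h o k t n hEm]
      ring
    · rw [(hint t n le_rfl).2 hq, mul_zero]
      have hset : {ω | T ω = t} ∩ observe S.m M X k ⁻¹' (G ∩ {h | OnPath o k h}) = ∅ := by
        rw [Set.eq_empty_iff_forall_notMem]
        rintro ω ⟨-, hω⟩
        exact hq ((hobs_iff ω).1 hω).2.1
      rw [hset, measure_empty]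
  rw [← hν hG, ← hν' hG, ext_of_generate_finite _ (generateFrom_rectangles k)
    (isPiSystem_rectangles k) key (key _ (univ_mem_rectangles k))]

theorem measure_changed (h : IsModel S.m S.σ S.p ρ S.F₀ S.F₁ μ T M X) (hρ : ρ ≤ 1) (k : ℕ)
    {G : Set (Hist N 𝒳 k)} (hG : MeasurableSet G) :
    μ ({ω | T ω ≤ k} ∩ observe S.m M X k ⁻¹' G) =
      ∫⁻ h in G, S.changedWeight k (histState S.m k h) (S.early ρ k h) (S.late ρ k h)
        ∂S.refLaw N k := by
  have hobs : Measurable (observe S.m M X k) := measurable_observe h.measurable_M h.measurable_X k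
  have hset : {ω | T ω ≤ k} ∩ observe S.m M X k ⁻¹' G =
      ⋃ t ∈ Finset.range (k + 1), {ω | T ω = t} ∩ observe S.m M X k ⁻¹' G := by
    ext ω
    simp
  rw [hset, measure_biUnion_finset]
  · simp only [measure_changeTime_inter_observe h _ k hG]
    simp only [← lintegral_const_mul _ (S.measurable_likelihood _ k)]
    rw [← lintegral_finsetSum _ fun t _ => (S.measurable_likelihood t k).const_mul _]
    refine lintegral_congr_ae (ae_restrict_of_ae ?_)
    filter_upwards [S.ae_plausible k] with h hh
    exact S.sum_prior_mul_likelihood hρ hh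
  · intro t _ t' _ htt
    refine Set.disjoint_left.2 ?_
    rintro ω ⟨h1, -⟩ ⟨h2, -⟩
    exact htt (h1.symm.trans h2)
  · exact fun t _ => (h.measurable_T (measurableSet_singleton t)).inter (hobs hG)

theorem measure_unchanged (h : IsModel S.m S.σ S.p ρ S.F₀ S.F₁ μ T M X) (hρ : ρ ≤ 1) (k : ℕ)
    {G : Set (Hist N 𝒳 k)} (hG : MeasurableSet G) :
    μ ({ω | k < T ω} ∩ observe S.m M X k ⁻¹' G) =
      ∫⁻ h in G, S.stopCost k (histState S.m k h) (S.late ρ k h) ∂S.refLaw N k := by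
  have hobs : Measurable (observe S.m M X k) := measurable_observe h.measurable_M h.measurable_X k
  have hset : {ω | k < T ω} ∩ observe S.m M X k ⁻¹' G =
      ⋃ l, {ω | T ω = k + 1 + l} ∩ observe S.m M X k ⁻¹' G := by
    ext ω
    simp only [Set.mem_inter_iff, Set.mem_ofPred_eq, Set.mem_iUnion]
    constructor
    · rintro ⟨h1, h2⟩
      exact ⟨T ω - (k + 1), by omega, h2⟩
    · rintro ⟨l, h1, h2⟩
      exact ⟨by omega, h2⟩
  rw [hset, measure_iUnion]
  · simp only [measure_changeTime_inter_observe h _ k hG]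
    simp only [← lintegral_const_mul _ (S.measurable_likelihood _ k)]
    rw [← lintegral_tsum fun t => ((S.measurable_likelihood _ k).const_mul _).aemeasurable]
    refine lintegral_congr_ae (ae_restrict_of_ae ?_)
    filter_upwards [S.ae_plausible k] with h hh
    exact S.tsum_prior_mul_likelihood hρ hh
  · intro t t' htt
    refine Set.disjoint_left.2 ?_
    rintro ω ⟨h1, -⟩ ⟨h2, -⟩
    simp only [Set.mem_ofPred_eq] at h1 h2
    omega
  · exact fun t => (h.measurable_T (measurableSet_singleton _)).inter (hobs hG)

theorem measure_observe (h : IsModel S.m S.σ S.p ρ S.F₀ S.F₁ μ T M X) (hρ : ρ ≤ 1) (k : ℕ)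
    {G : Set (Hist N 𝒳 k)} (hG : MeasurableSet G) :
    μ (observe S.m M X k ⁻¹' G) = ∫⁻ h in G, (S.early ρ k h + S.late ρ k h) ∂S.refLaw N k := by
  have hT : MeasurableSet {ω | T ω ≤ k} := h.measurable_T measurableSet_Iic
  have hcompl : {ω | T ω ≤ k}ᶜ = {ω | k < T ω} := by
    ext ω
    simp
  rw [← measure_inter_add_sdiff _ hT, Set.sdiff_eq, hcompl, Set.inter_comm, measure_changed h hρ k hG,
    Set.inter_comm, measure_unchanged h hρ k hG, ← lintegral_add_right]
  · refine lintegral_congr fun h => ?_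
    rw [add_comm, stopCost_add_changedWeight]
  · exact S.measurable_of_forall_state (f := fun s h => S.stopCost k s (S.late ρ k h)) fun s =>
      (S.measurable_late k).const_mul _

theorem map_observe (h : IsModel S.m S.σ S.p ρ S.F₀ S.F₁ μ T M X) (hρ : ρ ≤ 1) (k : ℕ) :
    μ.map (observe S.m M X k) =
      (S.refLaw N k).withDensity fun h => S.early ρ k h + S.late ρ k h := by
  ext G hG
  rw [Measure.map_apply (measurable_observe h.measurable_M h.measurable_X k) hG,
    measure_observe h hρ k hG, withDensity_apply _ hG]

end Setting

end NADM

namespace NADM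

/-! ### Stopping policies -/

/-- The histories after which the policy `A` has not stopped earlier. -/
def alive {N : ℕ} {𝒳 : Type*} (A : ∀ k, Set (Hist N 𝒳 k)) : ∀ k, Set (Hist N 𝒳 k)
  | 0 => Set.univ
  | k + 1 => Prod.fst ⁻¹' (alive A k \ A k)

theorem measurableSet_alive {N : ℕ} {𝒳 : Type*} [MeasurableSpace 𝒳] {A : ∀ k, Set (Hist N 𝒳 k)}
    (hA : ∀ k, MeasurableSet (A k)) (k : ℕ) : MeasurableSet (alive A k) := by
  induction k with
  | zero => exact MeasurableSet.univ
  | succ k ih => exact measurable_fst (ih.diff (hA k))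

theorem observe_mem_alive {Ω 𝒳 : Type*} {N m : ℕ} {M : ℕ → Ω → Fin (N + 1)}
    {X : ℕ → Fin N → Ω → 𝒳} {A : ∀ k, Set (Hist N 𝒳 k)} {k : ℕ} {ω : Ω} :
    observe m M X k ω ∈ alive A k ↔ ∀ j < k, observe m M X j ω ∉ A j := by
  induction k with
  | zero => simp [alive]
  | succ k ih =>
    change observe m M X k ω ∈ alive A k \ A k ↔ _
    rw [Set.mem_sdiff, ih]
    constructor
    · rintro ⟨h1, h2⟩ j hj
      rcases Nat.lt_succ_iff_lt_or_eq.1 hj with h | rfl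
      · exact h1 j h
      · exact h2
    · exact fun h => ⟨fun j hj => h j (by omega), h k (by omega)⟩

/-- The delay counts the slots k with a ≤ k < τ, which spreads the delay cost over slots and covers
τ = ∞. -/
theorem tsum_indicator_delay (a : ℕ) (τ : ℕ∞) :
    ∑' k : ℕ, {k : ℕ | a ≤ k ∧ (k : ℕ∞) < τ}.indicator (1 : ℕ → ℝ≥0∞) k =
      ((τ - (a : ℕ∞) : ℕ∞) : ℝ≥0∞) := by
  rw [← tsum_subtype]
  simp only [Pi.one_apply]
  rw [ENNReal.tsum_set_one]
  congr 1
  induction τ using ENat.recTopCoe with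
  | top =>
    have : {k : ℕ | a ≤ k ∧ (k : ℕ∞) < ⊤} = Set.Ici a := by
      ext k
      simp
    rw [this, (Set.Ici_infinite a).encard_eq]
    exact (ENat.top_sub_natCast a).symm
  | coe n =>
    have : {k : ℕ | a ≤ k ∧ (k : ℕ∞) < (n : ℕ∞)} = (Finset.Ico a n : Set ℕ) := by
      ext k
      simp
    rw [this, Set.encard_coe_eq_coe_finsetCard, Nat.card_Ico]
    exact ENat.natCast_sub n a

namespace Setting

variable {𝒳 : Type*} [MeasurableSpace 𝒳] (S : Setting 𝒳) {N : ℕ} {ρ : ℝ}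

/-- Expected cost of the policy `A` in slot `k`. -/
noncomputable def stageCost (ρ : ℝ) (A : ∀ k, Set (Hist N 𝒳 k)) (k : ℕ) : ℝ≥0∞ :=
  ∫⁻ h in alive A k ∩ A k, S.stopCost k (histState S.m k h) (S.late ρ k h) ∂S.refLaw N k +
    ENNReal.ofReal S.c * ∫⁻ h in alive A k \ A k,
      S.changedWeight k (histState S.m k h) (S.early ρ k h) (S.late ρ k h) ∂S.refLaw N k

theorem measurable_comp_weights {V : NetState N → ℝ≥0∞ → ℝ≥0∞ → ℝ≥0∞}
    (hV : ∀ s, Measurable fun x : ℝ≥0∞ × ℝ≥0∞ => V s x.1 x.2) (k : ℕ) :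
    Measurable fun h : Hist N 𝒳 k => V (histState S.m k h) (S.early ρ k h) (S.late ρ k h) :=
  S.measurable_of_forall_state (f := fun s h => V s (S.early ρ k h) (S.late ρ k h)) fun s =>
    (hV s).comp ((S.measurable_early k).prodMk (S.measurable_late k))

theorem measurable_stopCost (k : ℕ) : Measurable fun h : Hist N 𝒳 k =>
    S.stopCost k (histState S.m k h) (S.late ρ k h) :=
  S.measurable_comp_weights (V := fun s _ w => S.stopCost k s w)
    (fun _ => measurable_snd.const_mul _) k

theorem measurable_changedWeight (k : ℕ) : Measurable fun h : Hist N 𝒳 k =>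
    S.changedWeight k (histState S.m k h) (S.early ρ k h) (S.late ρ k h) :=
  S.measurable_comp_weights (V := S.changedWeight k)
    (fun _ => measurable_fst.add (measurable_snd.const_mul _)) k

theorem measurable_total (k : ℕ) :
    Measurable fun h : Hist N 𝒳 k => S.early ρ k h + S.late ρ k h :=
  (S.measurable_early k).add (S.measurable_late k)

theorem setLIntegral_cont (hρ : ρ ≤ 1) {V : ℕ → NetState N → ℝ≥0∞ → ℝ≥0∞ → ℝ≥0∞}
    (hV : ∀ k s, Measurable fun x : ℝ≥0∞ × ℝ≥0∞ => V k s x.1 x.2) {A : ∀ k, Set (Hist N 𝒳 k)}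
    (hA : ∀ k, MeasurableSet (A k)) (k : ℕ) :
    ∫⁻ h in alive A k \ A k, (ENNReal.ofReal S.c *
        S.changedWeight k (histState S.m k h) (S.early ρ k h) (S.late ρ k h) +
          S.expectNext V k (histState S.m k h) (S.early ρ k h) (S.late ρ k h)) ∂S.refLaw N k =
      ENNReal.ofReal S.c * ∫⁻ h in alive A k \ A k,
        S.changedWeight k (histState S.m k h) (S.early ρ k h) (S.late ρ k h) ∂S.refLaw N k +
      ∫⁻ h in alive A (k + 1), V (k + 1) (histState S.m (k + 1) h) (S.early ρ (k + 1) h)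
        (S.late ρ (k + 1) h) ∂S.refLaw N (k + 1) := by
  rw [lintegral_add_left ((S.measurable_changedWeight k).const_mul _),
    lintegral_const_mul _ (S.measurable_changedWeight k),
    ← S.setLIntegral_next hρ hV k ((measurableSet_alive hA k).diff (hA k))]
  rfl

/-- Any policy costs at least the optimal cost of stopping within `n` slots, up to the cost of
stopping after these `n` slots. -/
theorem setLIntegral_valueIter_le (hρ : ρ ≤ 1) {A : ∀ k, Set (Hist N 𝒳 k)}
    (hA : ∀ k, MeasurableSet (A k)) (n k : ℕ) :
    ∫⁻ h in alive A k, S.valueIter n k (histState S.m k h) (S.early ρ k h) (S.late ρ k h)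
        ∂S.refLaw N k ≤
      ∑ i ∈ Finset.range n, S.stageCost ρ A (k + i) +
        ∫⁻ h in alive A (k + n), S.stopCost (k + n) (histState S.m (k + n) h)
          (S.late ρ (k + n) h) ∂S.refLaw N (k + n) := by
  induction n generalizing k with
  | zero => simp [valueIter]
  | succ n ih =>
    rw [← lintegral_inter_add_sdiff _ _ (hA k)]
    have h1 : ∫⁻ h in alive A k ∩ A k, S.valueIter (n + 1) k (histState S.m k h) (S.early ρ k h)
        (S.late ρ k h) ∂S.refLaw N k ≤
        ∫⁻ h in alive A k ∩ A k, S.stopCost k (histState S.m k h) (S.late ρ k h) ∂S.refLaw N k :=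
      lintegral_mono fun h => min_le_left _ _
    have h2 : ∫⁻ h in alive A k \ A k, S.valueIter (n + 1) k (histState S.m k h) (S.early ρ k h)
        (S.late ρ k h) ∂S.refLaw N k ≤ _ :=
      (lintegral_mono fun h => min_le_right _ _).trans
        (S.setLIntegral_cont hρ (S.measurable_valueIter n) hA k).le
    have h3 := ih (k + 1)
    have h4 : ∑ i ∈ Finset.range (n + 1), S.stageCost ρ A (k + i) =
        ∑ i ∈ Finset.range n, S.stageCost ρ A (k + 1 + i) + S.stageCost ρ A k := by
      rw [Finset.sum_range_succ']
      simp only [add_zero, add_right_comm k 1, ← add_assoc]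
    rw [h4, show k + (n + 1) = k + 1 + n by omega]
    refine (add_le_add h1 (h2.trans (add_le_add_right h3 _))).trans (le_of_eq ?_)
    unfold stageCost
    ring

/-- Together with `contValue_zero`, this handles histories of zero total weight, on which the
optimality assumption on a policy says nothing. -/
theorem value_zero (k : ℕ) (s : NetState N) : S.value k s 0 0 = 0 :=
  le_antisymm ((iInf_le _ 0).trans (by simp [valueIter, stopCost])) (zero_le)

theorem contValue_zero (k : ℕ) (s : NetState N) :
    ENNReal.ofReal S.c * S.changedWeight k s 0 0 + S.expectNext S.value k s 0 0 = 0 := by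
  simp [changedWeight, expectNext, nextEarly, nextLate, value_zero]

/-- A policy which stops when this is optimal attains the optimal cost. -/
theorem sum_stageCost_le (hρ : ρ ≤ 1) {A : ∀ k, Set (Hist N 𝒳 k)}
    (hA : ∀ k, MeasurableSet (A k))
    (hopt : ∀ k, ∀ᵐ h ∂S.refLaw N k, S.early ρ k h + S.late ρ k h ≠ 0 → h ∈ alive A k →
      (h ∈ A k ↔ S.StopOptimal k (histState S.m k h) (S.early ρ k h) (S.late ρ k h))) (n : ℕ) :
    ∑ k ∈ Finset.range n, S.stageCost ρ A k +
        ∫⁻ h in alive A n, S.value n (histState S.m n h) (S.early ρ n h) (S.late ρ n h)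
          ∂S.refLaw N n ≤
      ∫⁻ h, S.value 0 (histState S.m 0 h) (S.early ρ 0 h) (S.late ρ 0 h) ∂S.refLaw N 0 := by
  induction n with
  | zero => simp [alive]
  | succ n ih =>
    refine le_trans ?_ ih
    rw [Finset.sum_range_succ, add_assoc]
    refine add_le_add_right ?_ _
    rw [← lintegral_inter_add_sdiff _ (alive A n) (hA n), stageCost, add_assoc,
      ← S.setLIntegral_cont hρ S.measurable_value hA n]
    have hz : ∀ h : Hist N 𝒳 n, S.early ρ n h + S.late ρ n h = 0 →
        S.early ρ n h = 0 ∧ S.late ρ n h = 0 := fun h => add_eq_zero.1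
    refine add_le_add ?_ ?_
    · refine setLIntegral_mono_ae' ((measurableSet_alive hA n).inter (hA n)) ?_
      filter_upwards [hopt n] with h hh hmem
      by_cases h0 : S.early ρ n h + S.late ρ n h = 0
      · rw [(hz h h0).2]
        simp [stopCost]
      · exact S.stopCost_le_value ((hh h0 hmem.1).1 hmem.2)
    · refine setLIntegral_mono_ae' ((measurableSet_alive hA n).diff (hA n)) ?_
      filter_upwards [hopt n] with h hh hmem
      by_cases h0 : S.early ρ n h + S.late ρ n h = 0
      · rw [(hz h h0).1, (hz h h0).2, contValue_zero]
        exact zero_le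
      · exact S.contValue_le_value fun h1 => hmem.2 ((hh h0 hmem.1).2 h1)

variable {Ω : Type*} [MeasurableSpace Ω] {S}
  {μ : Measure Ω} [IsProbabilityMeasure μ] {T : Ω → ℕ} {M : ℕ → Ω → Fin (N + 1)}
  {X : ℕ → Fin N → Ω → 𝒳}

/-- The risk of a decision time is the total cost of the policy it follows. -/
theorem risk_eq_tsum (h : IsModel S.m S.σ S.p ρ S.F₀ S.F₁ μ T M X) (hρ : ρ ≤ 1)
    {A : ∀ k, Set (Hist N 𝒳 k)} (hA : ∀ k, MeasurableSet (A k)) {τ : Ω → ℕ∞}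
    (hτ : ∀ ω (k : ℕ), τ ω ≤ k ↔ ∃ j ≤ k, observe S.m M X j ω ∈ A j) :
    risk S.c μ T τ = ∑' k, S.stageCost ρ A k := by
  have hobs : ∀ k, Measurable (observe S.m M X k) := fun k =>
    measurable_observe h.measurable_M h.measurable_X k
  have hal := measurableSet_alive hA
  have hlt : ∀ ω (k : ℕ), (k : ℕ∞) < τ ω ↔ observe S.m M X k ω ∈ alive A k \ A k := by
    intro ω k
    rw [← not_le, hτ, Set.mem_sdiff, observe_mem_alive]
    push Not
    exact ⟨fun h => ⟨fun j hj => h j hj.le, h k le_rfl⟩, fun h j hj =>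
      hj.lt_or_eq.elim (fun h' => h.1 j h') fun h' => h' ▸ h.2⟩
  have heq : ∀ ω (k : ℕ), τ ω = k ↔ observe S.m M X k ω ∈ alive A k ∩ A k := by
    intro ω k
    have h1 : τ ω = k ↔ τ ω ≤ k ∧ ∀ j < k, ¬ τ ω ≤ (j : ℕ) := by
      constructor
      · intro h
        refine ⟨h.le, fun j hj h2 => ?_⟩
        rw [h] at h2
        exact absurd (Nat.cast_le.1 h2) (by omega)
      · rintro ⟨h2, h3⟩
        refine h2.antisymm (not_lt.1 fun h4 => ?_)
        obtain ⟨j, hj⟩ := ENat.ne_top_iff_exists.1 (ne_top_of_lt h4)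
        rw [← hj] at h4
        exact h3 j (Nat.cast_lt.1 h4) hj.symm.le
    rw [h1, Set.mem_inter_iff, observe_mem_alive]
    simp only [hτ]
    push Not
    constructor
    · rintro ⟨⟨j, hj, hjA⟩, h3⟩
      refine ⟨fun i hi => h3 i hi i le_rfl, ?_⟩
      rcases hj.lt_or_eq with h4 | rfl
      · exact absurd hjA (h3 j h4 j le_rfl)
      · exact hjA
    · rintro ⟨h3, h4⟩
      exact ⟨⟨k, le_rfl, h4⟩, fun j hj i hi => h3 i (by omega)⟩
  have hfalse : μ {ω | τ ω < (T ω : ℕ∞)} = ∑' k, ∫⁻ h in alive A k ∩ A k,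
      S.stopCost k (histState S.m k h) (S.late ρ k h) ∂S.refLaw N k := by
    have hset : {ω | τ ω < (T ω : ℕ∞)} =
        ⋃ k : ℕ, {ω | k < T ω} ∩ observe S.m M X k ⁻¹' (alive A k ∩ A k) := by
      ext ω
      rw [Set.mem_iUnion]
      constructor
      · intro hω
        obtain ⟨k, hk⟩ := ENat.ne_top_iff_exists.1 (ne_top_of_lt hω)
        refine ⟨k, ?_, (heq ω k).1 hk.symm⟩
        have hω' : τ ω < (T ω : ℕ∞) := hω
        rw [← hk] at hω'
        exact Nat.cast_lt.1 hω'
      · rintro ⟨k, h1, h2⟩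
        change τ ω < (T ω : ℕ∞)
        rw [(heq ω k).2 h2]
        exact Nat.cast_lt.2 h1
    rw [hset, measure_iUnion]
    · exact tsum_congr fun k => measure_unchanged h hρ k ((hal k).inter (hA k))
    · intro i j hij
      refine Set.disjoint_left.2 ?_
      rintro ω ⟨-, h1⟩ ⟨-, h2⟩
      have := ((heq ω i).2 h1).symm.trans ((heq ω j).2 h2)
      exact hij (Nat.cast_injective this)
    · exact fun k => (h.measurable_T measurableSet_Ioi).inter (hobs k ((hal k).inter (hA k)))
  have hdelay : ∫⁻ ω, ((τ ω - (T ω : ℕ∞) : ℕ∞) : ℝ≥0∞) ∂μ =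
      ∑' k, ∫⁻ h in alive A k \ A k,
        S.changedWeight k (histState S.m k h) (S.early ρ k h) (S.late ρ k h) ∂S.refLaw N k := by
    have hms : ∀ k, MeasurableSet ({ω | T ω ≤ k} ∩ observe S.m M X k ⁻¹' (alive A k \ A k)) :=
      fun k => (h.measurable_T measurableSet_Iic).inter (hobs k ((hal k).diff (hA k)))
    have hpt : ∀ ω, ((τ ω - (T ω : ℕ∞) : ℕ∞) : ℝ≥0∞) = ∑' k : ℕ,
        ({ω | T ω ≤ k} ∩ observe S.m M X k ⁻¹' (alive A k \ A k)).indicator 1 ω := by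
      intro ω
      rw [← tsum_indicator_delay]
      refine tsum_congr fun k => ?_
      refine Set.indicator_eq_indicator ?_ rfl
      change T ω ≤ k ∧ (k : ℕ∞) < τ ω ↔ T ω ≤ k ∧ _
      rw [hlt]
      rfl
    simp only [hpt]
    rw [lintegral_tsum fun k => (measurable_one.indicator (hms k)).aemeasurable]
    refine tsum_congr fun k => ?_
    rw [lintegral_indicator_one (hms k)]
    exact measure_changed h hρ k ((hal k).diff (hA k))
  simp only [risk, stageCost]
  rw [hfalse, hdelay, ENNReal.tsum_add, ENNReal.tsum_mul_left]

/-- The optimal cost is a lower bound of the risk. -/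
theorem lintegral_value_le_risk (h : IsModel S.m S.σ S.p ρ S.F₀ S.F₁ μ T M X) (hρ : ρ ≤ 1)
    {τ : Ω → ℕ∞} (hτ : IsStoppingTime (information (m := S.m) h.measurable_M h.measurable_X) τ) :
    ∫⁻ h, S.value 0 (histState S.m 0 h) (S.early ρ 0 h) (S.late ρ 0 h) ∂S.refLaw N 0 ≤
      risk S.c μ T τ := by
  -- The event τ ≤ k, rather than τ = k, is written in terms of the history; only the first entry
  -- into these sets matters.
  have hex : ∀ k : ℕ, ∃ A : Set (Hist N 𝒳 k), MeasurableSet A ∧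
      observe S.m M X k ⁻¹' A = {ω | τ ω ≤ k} := fun k => by
    have := hτ k
    rw [information_eq_comap_observe] at this
    exact this
  choose A hA hAτ using hex
  have hmem : ∀ ω (k : ℕ), observe S.m M X k ω ∈ A k ↔ τ ω ≤ k := fun ω k => by
    rw [← Set.mem_preimage, hAτ]
    rfl
  have hτA : ∀ ω (k : ℕ), τ ω ≤ k ↔ ∃ j ≤ k, observe S.m M X j ω ∈ A j := by
    intro ω k
    constructor
    · exact fun h => ⟨k, le_rfl, (hmem ω k).2 h⟩
    · rintro ⟨j, hj, h⟩
      exact ((hmem ω j).1 h).trans (Nat.cast_le.2 hj)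
  rw [risk_eq_tsum h hρ hA hτA]
  -- Cutting the policy off after `n` slots adds at most the probability of a false alarm at time
  -- `n`.
  have hbound : ∀ n, ∫⁻ h, S.value 0 (histState S.m 0 h) (S.early ρ 0 h) (S.late ρ 0 h)
      ∂S.refLaw N 0 ≤ ∑' k, S.stageCost ρ A k + μ {ω | n < T ω} := by
    intro n
    have h1 := S.setLIntegral_valueIter_le hρ hA n 0
    have h2 : ∀ j, j = n → ∫⁻ h in alive A j, S.stopCost j (histState S.m j h) (S.late ρ j h)
        ∂S.refLaw N j ≤ μ {ω | n < T ω} := by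
      rintro _ rfl
      rw [← measure_unchanged h hρ _ (measurableSet_alive hA _)]
      exact measure_mono Set.inter_subset_left
    refine (lintegral_mono fun h => iInf_le _ n).trans ((setLIntegral_univ _).symm.le.trans
      (h1.trans (add_le_add ?_ (h2 _ (zero_add n)))))
    simp only [zero_add]
    exact ENNReal.sum_le_tsum _
  have hlim : Filter.Tendsto (fun n => μ {ω | n < T ω}) Filter.atTop (nhds 0) := by
    have hI : ⋂ n : ℕ, {ω | n < T ω} = ∅ := by
      rw [Set.eq_empty_iff_forall_notMem]
      intro ω hω
      exact absurd (Set.mem_iInter.1 hω (T ω)) (lt_irrefl (T ω))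
    have := tendsto_measure_iInter_atTop (μ := μ) (s := fun n : ℕ => {ω | n < T ω})
      (fun n => (h.measurable_T measurableSet_Ioi).nullMeasurableSet)
      (fun i j hij ω (hω : j < T ω) => lt_of_le_of_lt hij hω) ⟨0, measure_ne_top _ _⟩
    rwa [hI, measure_empty] at this
  have hlim' := hlim.const_add (∑' k, S.stageCost ρ A k)
  rw [add_zero] at hlim'
  exact ge_of_tendsto' hlim' hbound

theorem measurableSet_stopOptimal (S : Setting 𝒳) (ρ : ℝ) (k : ℕ) :
    MeasurableSet {h : Hist N 𝒳 k |
      S.StopOptimal k (histState S.m k h) (S.early ρ k h) (S.late ρ k h)} := by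
  have : {h : Hist N 𝒳 k |
      S.StopOptimal k (histState S.m k h) (S.early ρ k h) (S.late ρ k h)} =
      ⋂ n, {h | S.stopCost k (histState S.m k h) (S.late ρ k h) ≤
        S.contCost n k (histState S.m k h) (S.early ρ k h) (S.late ρ k h)} := by
    ext h
    rw [Set.mem_iInter]
    rfl
  rw [this]
  refine MeasurableSet.iInter fun n => measurableSet_le (S.measurable_stopCost k) ?_
  exact S.measurable_comp_weights (V := S.contCost n k) (fun s => Measurable.add
    (Measurable.const_mul (measurable_fst.add (measurable_snd.const_mul _)) _)
      (S.measurable_expectNext (S.measurable_valueIter n) k s)) k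

/-- A decision time which stops when this is optimal attains the optimal cost. -/
theorem risk_le_lintegral_value (h : IsModel S.m S.σ S.p ρ S.F₀ S.F₁ μ T M X) (hρ : ρ ≤ 1)
    {A : ∀ k, Set (Hist N 𝒳 k)} (hA : ∀ k, MeasurableSet (A k)) {τ : Ω → ℕ∞}
    (hτ : ∀ ω (k : ℕ), τ ω ≤ k ↔ ∃ j ≤ k, observe S.m M X j ω ∈ A j)
    (hopt : ∀ k, ∀ᵐ ω ∂μ, observe S.m M X k ω ∈ alive A k → (observe S.m M X k ω ∈ A k ↔
      S.StopOptimal k (histState S.m k (observe S.m M X k ω)) (S.early ρ k (observe S.m M X k ω))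
        (S.late ρ k (observe S.m M X k ω)))) :
    risk S.c μ T τ ≤
      ∫⁻ h, S.value 0 (histState S.m 0 h) (S.early ρ 0 h) (S.late ρ 0 h) ∂S.refLaw N 0 := by
  rw [risk_eq_tsum h hρ hA hτ]
  -- The remaining value is nonnegative and is dropped, so no argument for termination of the policy
  -- is required.
  refine ENNReal.tsum_le_of_sum_range_le fun n =>
    le_self_add.trans (S.sum_stageCost_le hρ hA (fun k => ?_) n)
  have hobs : Measurable (observe S.m M X k) := measurable_observe h.measurable_M h.measurable_X k
  have hms : MeasurableSet {h : Hist N 𝒳 k | h ∈ alive A k → (h ∈ A k ↔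
      S.StopOptimal k (histState S.m k h) (S.early ρ k h) (S.late ρ k h))} :=
    (measurableSet_alive hA k).imp ((hA k).iff (measurableSet_stopOptimal S ρ k))
  -- An almost sure statement under μ passes to the reference law only where the density, the total
  -- weight, is nonzero.
  have h1 := (ae_map_iff hobs.aemeasurable hms).2 (hopt k)
  rw [map_observe h hρ k] at h1
  exact (ae_withDensity_iff (S.measurable_total k)).1 h1

end Setting

end NADM

namespace NADM

namespace Setting

/-! ### The posterior probability of a change -/

section Posterior

variable {Ω 𝒳 : Type*} [MeasurableSpace Ω] [MeasurableSpace 𝒳] {S : Setting 𝒳} {N : ℕ} {ρ : ℝ}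
  {μ : Measure Ω} [IsProbabilityMeasure μ] {T : Ω → ℕ} {M : ℕ → Ω → Fin (N + 1)}
  {X : ℕ → Fin N → Ω → 𝒳}

theorem ae_total_ne_top (h : IsModel S.m S.σ S.p ρ S.F₀ S.F₁ μ T M X) (hρ : ρ ≤ 1) (k : ℕ) :
    ∀ᵐ h ∂S.refLaw N k, S.early ρ k h + S.late ρ k h ≠ ∞ := by
  have h1 := measure_observe h hρ k MeasurableSet.univ
  rw [setLIntegral_univ] at h1
  have h2 := ae_lt_top (S.measurable_total (N := N) (ρ := ρ) k)
    (h1 ▸ measure_ne_top μ _)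
  filter_upwards [h2] with h hh using hh.ne

/-- The total weight is the density of the observed history, hence almost surely nonzero and finite
under μ, and the normalized weights make sense. -/
theorem ae_total (h : IsModel S.m S.σ S.p ρ S.F₀ S.F₁ μ T M X) (hρ : ρ ≤ 1) (k : ℕ) :
    ∀ᵐ ω ∂μ, Plausible S.m k (observe S.m M X k ω) ∧
      S.early ρ k (observe S.m M X k ω) + S.late ρ k (observe S.m M X k ω) ≠ 0 ∧
      S.early ρ k (observe S.m M X k ω) + S.late ρ k (observe S.m M X k ω) ≠ ∞ := by
  have hobs : Measurable (observe S.m M X k) := measurable_observe h.measurable_M h.measurable_X k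
  refine ae_of_ae_map (p := fun x : Hist N 𝒳 k => Plausible S.m k x ∧
    S.early ρ k x + S.late ρ k x ≠ 0 ∧ S.early ρ k x + S.late ρ k x ≠ ∞) hobs.aemeasurable ?_
  rw [map_observe h hρ k]
  refine (ae_withDensity_iff (S.measurable_total k)).2 ?_
  filter_upwards [S.ae_plausible k, ae_total_ne_top h hρ k] with x h1 h2 h3
  exact ⟨h1, h3, h2⟩

theorem changedWeight_le (S : Setting 𝒳) (k : ℕ) (s : NetState N) (u w : ℝ≥0∞) :
    S.changedWeight k s u w ≤ u + w :=
  (S.stopCost_add_changedWeight k s u w) ▸ le_add_self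

/-- The ratio is a function of the history, and its integral over any history event is the
probability that the event and a change up to `k` both occur; this characterizes the conditional
expectation. -/
theorem posterior_ae_eq_ratio (h : IsModel S.m S.σ S.p ρ S.F₀ S.F₁ μ T M X) (hρ : ρ ≤ 1) (k : ℕ) :
    posterior μ T (information (m := S.m) h.measurable_M h.measurable_X) k =ᵐ[μ] fun ω =>
      (S.changedWeight k (histState S.m k (observe S.m M X k ω)) (S.early ρ k (observe S.m M X k ω))
          (S.late ρ k (observe S.m M X k ω)) /
        (S.early ρ k (observe S.m M X k ω) + S.late ρ k (observe S.m M X k ω))).toReal := by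
  have hobs : Measurable (observe S.m M X k) := measurable_observe h.measurable_M h.measurable_X k
  have hle := (information (m := S.m) h.measurable_M h.measurable_X).le k
  set r : Hist N 𝒳 k → ℝ≥0∞ := fun x =>
    S.changedWeight k (histState S.m k x) (S.early ρ k x) (S.late ρ k x) /
      (S.early ρ k x + S.late ρ k x) with hr
  have hrm : Measurable r := (S.measurable_changedWeight k).div (S.measurable_total k)
  have hr1 : ∀ x, r x ≤ 1 := fun x =>
    ENNReal.div_le_of_le_mul (by rw [one_mul]; exact changedWeight_le S _ _ _ _)
  have hT : MeasurableSet {ω | T ω ≤ k} := h.measurable_T measurableSet_Iic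
  have hint : Integrable (fun ω => (r (observe S.m M X k ω)).toReal) μ :=
    integrable_toReal_of_lintegral_ne_top (hrm.comp hobs).aemeasurable
      (ne_top_of_le_ne_top (measure_ne_top μ Set.univ)
        ((lintegral_mono fun ω => hr1 _).trans (by simp)))
  refine (ae_eq_condExp_of_forall_setIntegral_eq hle ((integrable_const (1 : ℝ)).indicator hT)
    (fun s _ _ => hint.integrableOn) ?_ ?_).symm
  · intro s hs _
    rw [information_eq_comap_observe] at hs
    obtain ⟨G, hG, rfl⟩ := hs
    have e1 : ∫ ω in observe S.m M X k ⁻¹' G, (r (observe S.m M X k ω)).toReal ∂μ =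
        (∫⁻ ω in observe S.m M X k ⁻¹' G, r (observe S.m M X k ω) ∂μ).toReal :=
      integral_toReal (hrm.comp hobs).aemeasurable
        (ae_of_all _ fun ω => (hr1 _).trans_lt ENNReal.one_lt_top)
    have e2 : ∫⁻ ω in observe S.m M X k ⁻¹' G, r (observe S.m M X k ω) ∂μ =
        μ ({ω | T ω ≤ k} ∩ observe S.m M X k ⁻¹' G) := by
      rw [← setLIntegral_map hG hrm hobs, map_observe h hρ k, measure_changed h hρ k hG,
        setLIntegral_withDensity_eq_setLIntegral_mul _ (S.measurable_total k) hrm hG]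
      refine lintegral_congr_ae (ae_restrict_of_ae ?_)
      filter_upwards [ae_total_ne_top h hρ k] with x hx
      simp only [Pi.mul_apply, hr]
      by_cases h0 : S.early ρ k x + S.late ρ k x = 0
      · have := changedWeight_le S k (histState S.m k x) (S.early ρ k x) (S.late ρ k x)
        rw [h0] at this
        rw [h0, le_zero_iff.1 this, zero_mul]
      · exact ENNReal.mul_div_cancel h0 hx
    rw [e1, e2, setIntegral_indicator hT, Set.inter_comm]
    simp [Measure.real]
  · refine (Measurable.stronglyMeasurable ?_).aestronglyMeasurable
    exact (hrm.comp (measurable_observe_information h.measurable_M h.measurable_X k)).ennreal_toReal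

/-- The posterior probability of a change in terms of the conditional probability of a change
after the reference time. -/
theorem posterior_ae_eq (h : IsModel S.m S.σ S.p ρ S.F₀ S.F₁ μ T M X) (hρ : ρ ≤ 1) (k : ℕ) :
    ∀ᵐ ω ∂μ, posterior μ T (information (m := S.m) h.measurable_M h.measurable_X) k ω =
      1 - (1 - S.p) ^ (k - (histState S.m k (observe S.m M X k ω)).B * S.m) *
        (S.late ρ k (observe S.m M X k ω) /
          (S.early ρ k (observe S.m M X k ω) + S.late ρ k (observe S.m M X k ω))).toReal := by
  filter_upwards [posterior_ae_eq_ratio h hρ k, ae_total h hρ k] with ω h1 h2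
  obtain ⟨-, h3, h4⟩ := h2
  rw [h1]
  set u := S.early ρ k (observe S.m M X k ω)
  set w := S.late ρ k (observe S.m M X k ω)
  set s := histState S.m k (observe S.m M X k ω)
  have h5 : S.stopCost k s w / (u + w) + S.changedWeight k s u w / (u + w) = 1 := by
    rw [ENNReal.div_add_div_same, stopCost_add_changedWeight, ENNReal.div_self h3 h4]
  have h6 : S.stopCost k s w / (u + w) = S.survival (k - s.B * S.m) * (w / (u + w)) :=
    mul_div_assoc _ _ _
  have h7 : (S.stopCost k s w / (u + w)).toReal + (S.changedWeight k s u w / (u + w)).toReal = 1 := by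
    rw [← ENNReal.toReal_add, h5, ENNReal.toReal_one]
    · exact ne_top_of_le_ne_top ENNReal.one_ne_top (h5 ▸ le_self_add)
    · exact ne_top_of_le_ne_top ENNReal.one_ne_top (h5 ▸ le_add_self)
  rw [h6, ENNReal.toReal_mul, survival, ENNReal.toReal_ofReal (S.pow_nonneg_p _)] at h7
  linarith

end Posterior

/-! ### The thresholds -/

section Thresholds

variable {𝒳 : Type*} [MeasurableSpace 𝒳] (S : Setting 𝒳)

/-- The configuration at time `0`. -/
def startState (N : ℕ) : NetState N := ⟨1, fun _ => 0, fun _ => 0, fun _ => false⟩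

open Classical in
/-- The threshold at the initial network state, which is attained at the time `0` and at the first
sampling instant. -/
noncomputable def initialThreshold (N : ℕ) (ρ : ℝ) : ℝ :=
  -- If stopping at time 0 is optimal, threshold 0 enforces it and time `m` is irrelevant.
  if 1 - ρ ≤ S.boundary 0 (startState N) then 0
  -- Otherwise, to stop at time `m`, the threshold is the deterministic posterior there, which
  -- exceeds the posterior at time 0.
  else if (1 - ρ) * (1 - S.p) ^ S.m ≤ S.boundary S.m (firstSamplingState N) then
    1 - (1 - ρ) * (1 - S.p) ^ S.m
  -- To stop at neither time, threshold 1 works, since in this case ρ < 1 and both posteriors are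
  -- below 1.
  else 1

open Classical in
/-- The optimal thresholds. -/
noncomputable def threshold (N : ℕ) (ρ : ℝ) (q : QueueState N) : ℝ :=
  if q = initialQueueState N S.m then S.initialThreshold N ρ
  -- The choice is harmless: a state other than the initial one comes from a single pair of slot and
  -- configuration.
  else if hq : ∃ x : ℕ × NetState N, Reachable S.m x.1 x.2 ∧ observedState S.m x.1 x.2 = q then
    1 - (1 - S.p) ^ (hq.choose.1 - hq.choose.2.B * S.m) * S.boundary hq.choose.1 hq.choose.2
  else 0

theorem initialThreshold_mem_Icc (N : ℕ) (ρ : ℝ) :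
    S.initialThreshold N ρ ∈ Set.Icc (0 : ℝ) 1 := by
  have h0 := S.boundary_mem_Icc 0 (startState N)
  have h1 := S.boundary_mem_Icc S.m (firstSamplingState N)
  unfold initialThreshold
  split_ifs with h2 h3
  · exact ⟨le_rfl, zero_le_one⟩
  -- Here `ρ` is an arbitrary real; the case conditions supply both bounds.
  · have : 0 ≤ (1 - ρ) * (1 - S.p) ^ S.m :=
      mul_nonneg (by linarith [h0.1]) (S.pow_nonneg_p _)
    exact ⟨by linarith [h1.2], by linarith⟩
  · exact ⟨zero_le_one, le_rfl⟩

theorem threshold_mem_Icc (N : ℕ) (ρ : ℝ) (q : QueueState N) :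
    S.threshold N ρ q ∈ Set.Icc (0 : ℝ) 1 := by
  unfold threshold
  split_ifs with h1 h2
  · exact S.initialThreshold_mem_Icc N ρ
  · have h3 := S.boundary_mem_Icc h2.choose.1 h2.choose.2
    have h4 := S.pow_nonneg_p (h2.choose.1 - h2.choose.2.B * S.m)
    have h5 := S.pow_le_one_p (h2.choose.1 - h2.choose.2.B * S.m)
    exact ⟨by linarith [mul_le_one₀ h5 h3.1 h3.2], by linarith [mul_nonneg h4 h3.1]⟩
  · exact ⟨le_rfl, zero_le_one⟩

theorem threshold_congr {N : ℕ} (ρ ρ' : ℝ) {q : QueueState N} (hq : q ≠ initialQueueState N S.m) :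
    S.threshold N ρ q = S.threshold N ρ' q := by
  unfold threshold
  rw [if_neg hq, if_neg hq]

theorem threshold_observedState {N : ℕ} (hN : 1 ≤ N) (ρ : ℝ) {k : ℕ} {s : NetState N}
    (hs : Reachable S.m k s) (hq : observedState S.m k s ≠ initialQueueState N S.m) :
    S.threshold N ρ (observedState S.m k s) =
      1 - (1 - S.p) ^ (k - s.B * S.m) * S.boundary k s := by
  have hex : ∃ x : ℕ × NetState N, Reachable S.m x.1 x.2 ∧
      observedState S.m x.1 x.2 = observedState S.m k s := ⟨(k, s), hs, rfl⟩
  unfold threshold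
  rw [if_neg hq, dif_pos hex]
  have h1 := hex.choose_spec
  obtain ⟨h2, h3⟩ := hs.eq_of_observedState hN S.one_le_m h1.1 h1.2.symm hq
  rw [← h2, ← h3]

variable {S} {N : ℕ} {ρ : ℝ}

/-- Up to time `m` all likelihoods equal one, so the weights are the prior probabilities. -/
theorem total_eq_one (hρ : ρ ∈ Set.Icc (0 : ℝ) 1) {k : ℕ} (hk : k ≤ S.m) {h : Hist N 𝒳 k}
    (hh : Plausible S.m k h) : S.early ρ k h + S.late ρ k h = 1 ∧
      S.late ρ k h = ENNReal.ofReal ((1 - ρ) * (1 - S.p) ^ k) := by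
  have hB := Nat.mul_le_mul_right S.m (hh.reachable S.one_le_m).B_pos
  have hr : refTime S.m k (histState S.m k h) = k := by
    unfold refTime
    omega
  have hl : S.late ρ k h = S.priorTail ρ k := by
    rw [late, S.likelihood_eq_one hh hk, mul_one, hr]
  refine ⟨?_, hl⟩
  have he : S.early ρ k h = S.prior ρ 0 + S.priorTail ρ 0 * S.onset k := by
    rw [early, hr, sum_range_add_of_le (Nat.zero_le k), ← S.sum_prior hρ.2]
    simp [S.likelihood_eq_one hh hk]
  have ht : S.priorTail ρ k = S.priorTail ρ 0 * S.survival k := by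
    rw [← S.priorTail_add hρ.2, zero_add]
  rw [hl, he, ht, add_assoc, ← mul_add, add_comm (S.onset k), survival_add_onset, mul_one, prior,
    priorTail, if_pos rfl, pow_zero, mul_one, ← ENNReal.ofReal_add hρ.1 (by linarith [hρ.2])]
  simp

end Thresholds

section Optimality

variable {Ω 𝒳 : Type*} [MeasurableSpace Ω] [MeasurableSpace 𝒳] {S : Setting 𝒳} {N : ℕ} {ρ : ℝ}
  {μ : Measure Ω} [IsProbabilityMeasure μ] {T : Ω → ℕ} {M : ℕ → Ω → Fin (N + 1)}
  {X : ℕ → Fin N → Ω → 𝒳}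

theorem posterior_ae_eq_of_le (h : IsModel S.m S.σ S.p ρ S.F₀ S.F₁ μ T M X)
    (hρ : ρ ∈ Set.Icc (0 : ℝ) 1) {k : ℕ} (hk : k ≤ S.m) :
    ∀ᵐ ω ∂μ, posterior μ T (information (m := S.m) h.measurable_M h.measurable_X) k ω =
        1 - (1 - ρ) * (1 - S.p) ^ k ∧
      (S.late ρ k (observe S.m M X k ω) /
        (S.early ρ k (observe S.m M X k ω) + S.late ρ k (observe S.m M X k ω))).toReal =
          (1 - ρ) * (1 - S.p) ^ k := by
  filter_upwards [posterior_ae_eq h hρ.2 k, ae_total h hρ.2 k] with ω h1 h2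
  obtain ⟨h3, h4⟩ := total_eq_one hρ hk h2.1
  have hB := Nat.mul_le_mul_right S.m (h2.1.reachable S.one_le_m).B_pos
  have h5 : (S.late ρ k (observe S.m M X k ω) / (S.early ρ k (observe S.m M X k ω) +
      S.late ρ k (observe S.m M X k ω))).toReal = (1 - ρ) * (1 - S.p) ^ k := by
    rw [h3, div_one, h4, ENNReal.toReal_ofReal
      (mul_nonneg (by linarith [hρ.2]) (S.pow_nonneg_p k))]
  refine ⟨?_, h5⟩
  rw [h1, h5, show k - (histState S.m k (observe S.m M X k ω)).B * S.m = 0 by omega, pow_zero,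
    one_mul]

/-- As long as it has not stopped, the threshold rule stops if and only if this is optimal. -/
theorem ae_threshold_le_iff (hN : 1 ≤ N) (h : IsModel S.m S.σ S.p ρ S.F₀ S.F₁ μ T M X)
    (hρ : ρ ∈ Set.Icc (0 : ℝ) 1) (k : ℕ) :
    ∀ᵐ ω ∂μ, (∀ j < k, ¬ S.threshold N ρ (Q S.m M j ω) ≤
        posterior μ T (information (m := S.m) h.measurable_M h.measurable_X) j ω) →
      (S.threshold N ρ (Q S.m M k ω) ≤
          posterior μ T (information (m := S.m) h.measurable_M h.measurable_X) k ω ↔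
        S.StopOptimal k (histState S.m k (observe S.m M X k ω)) (S.early ρ k (observe S.m M X k ω))
          (S.late ρ k (observe S.m M X k ω))) := by
  filter_upwards [posterior_ae_eq h hρ.2 k, ae_total h hρ.2 k,
    posterior_ae_eq_of_le h hρ (Nat.zero_le S.m), posterior_ae_eq_of_le h hρ (le_refl S.m)] with
    ω h1 h2 h3 h4 hnot
  obtain ⟨h5, h6, h7⟩ := h2
  have hreach := h5.reachable S.one_le_m
  have hQ := Q_eq_observedState (m := S.m) (M := M) (X := X) k ω
  rw [S.stopOptimal_iff h6 h7]
  by_cases hq : Q S.m M k ω = initialQueueState N S.m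
  · have hthr : ∀ j, Q S.m M j ω = initialQueueState N S.m →
        S.threshold N ρ (Q S.m M j ω) = S.initialThreshold N ρ := fun j hj => by
      rw [threshold, if_pos hj]
    have hQ0 : Q S.m M 0 ω = initialQueueState N S.m := by
      simp [Q, queueState, netState, slotsToGo, initialQueueState]
    have hpm : (1 - S.p) ^ S.m < 1 :=
      pow_lt_one₀ (by linarith [S.p_lt_one]) (by linarith [S.p_pos])
        (Nat.one_le_iff_ne_zero.1 S.one_le_m)
    have hb0 := S.boundary_mem_Icc 0 (startState N)
    have hst0 : histState S.m 0 (observe S.m M X 0 ω) = startState N := rfl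
    rw [pow_zero, mul_one] at h3
    rcases eq_zero_or_eq_of_observedState_initial S.one_le_m (hQ ▸ hq) with rfl | rfl
    · rw [hthr 0 hq, h3.1, h3.2, hst0]
      unfold initialThreshold
      split_ifs with c1 c2
      · exact ⟨fun _ => c1, fun _ => by linarith [hρ.1]⟩
      · refine ⟨fun h => ?_, fun h => absurd h c1⟩
        -- The threshold is strictly above the posterior at time 0, because `1 - ρ > 0` and `(1 - p)
        -- ^ m < 1`.
        nlinarith [hb0.1]
      · refine ⟨fun h => ?_, fun h => absurd h c1⟩
        linarith [hb0.1]
    -- Being still active at time `m` rules out the case in which the rule stops at time 0.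
    · have hn := hnot 0 S.one_le_m
      rw [hthr 0 hQ0, h3.1] at hn
      rw [hthr _ hq, h4.1, h4.2, hreach.eq_firstSamplingState hN S.one_le_m]
      unfold initialThreshold at hn ⊢
      split_ifs at hn ⊢ with c1 c2
      · exact absurd hn (by linarith [hρ.1])
      · exact ⟨fun _ => c2, fun _ => le_rfl⟩
      · refine ⟨fun h => ?_, fun h => absurd h c2⟩
        have := mul_pos (show 0 < 1 - ρ by linarith [hb0.1]) (S.pow_pos_p S.m)
        linarith
  · rw [hQ] at hq ⊢
    -- Posterior and threshold are the same decreasing affine function, evaluated at the late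
    -- fraction and at the boundary.
    rw [S.threshold_observedState hN ρ hreach hq, h1]
    rw [sub_le_sub_iff_left]
    exact mul_le_mul_iff_right₀ (S.pow_pos_p _)

end Optimality

end Setting

/-! ### The threshold rule is a stopping time and attains the optimal cost -/

theorem thresholdRule_le_iff {Ω : Type*} {N : ℕ} {γ : QueueState N → ℝ} {P : ℕ → Ω → ℝ}
    {q : ℕ → Ω → QueueState N} {ω : Ω} {k : ℕ} :
    thresholdRule γ P q ω ≤ k ↔ ∃ j ≤ k, γ (q j ω) ≤ P j ω := by
  unfold thresholdRule
  constructor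
  · intro h
    have hne : {n : ℕ∞ | ∃ k : ℕ, n = k ∧ γ (q k ω) ≤ P k ω}.Nonempty := by
      by_contra hcon
      rw [Set.not_nonempty_iff_eq_empty.1 hcon, sInf_empty] at h
      exact absurd h (by simp)
    obtain ⟨j, hj, hle⟩ := csInf_mem hne
    rw [hj] at h
    exact ⟨j, Nat.cast_le.1 h, hle⟩
  · rintro ⟨j, hj, hle⟩
    have hmem : (j : ℕ∞) ∈ {n : ℕ∞ | ∃ k : ℕ, n = k ∧ γ (q k ω) ≤ P k ω} := ⟨j, rfl, hle⟩
    exact (sInf_le hmem).trans (Nat.cast_le.2 hj)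

end NADM

theorem theorem3 {𝒳 : Type*} [MeasurableSpace 𝒳]
    (N : ℕ) (hN : 1 ≤ N) (m : ℕ) (hm : 1 ≤ m)
    (σ : ℝ) (hσ0 : 0 < σ) (hσ1 : σ < 1)
    (p : ℝ) (hp0 : 0 < p) (hp1 : p < 1)
    (c : ℝ) (hc : 0 < c)
    (F₀ F₁ : Measure 𝒳) [IsProbabilityMeasure F₀] [IsProbabilityMeasure F₁] :
    ∃ γ : ℝ → NADM.QueueState N → ℝ,
      (∀ ρ q, γ ρ q ∈ Set.Icc (0 : ℝ) 1) ∧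
      (∀ ρ ρ' q, q ≠ NADM.initialQueueState N m → γ ρ q = γ ρ' q) ∧
      ∀ ρ ∈ Set.Icc (0 : ℝ) 1,
      ∀ (Ω : Type*) [MeasurableSpace Ω] (μ : Measure Ω) [IsProbabilityMeasure μ]
        (T : Ω → ℕ) (M : ℕ → Ω → Fin (N + 1)) (X : ℕ → Fin N → Ω → 𝒳)
        (h : NADM.IsModel m σ p ρ F₀ F₁ μ T M X),
        IsStoppingTime (NADM.information (m := m) h.measurable_M h.measurable_X)
          (NADM.thresholdRule (γ ρ)
            (NADM.posterior μ T (NADM.information (m := m) h.measurable_M h.measurable_X))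
            (NADM.Q m M)) ∧
        ∀ τ : Ω → ℕ∞,
          IsStoppingTime (NADM.information (m := m) h.measurable_M h.measurable_X) τ →
          NADM.risk c μ T
            (NADM.thresholdRule (γ ρ)
              (NADM.posterior μ T (NADM.information (m := m) h.measurable_M h.measurable_X))
              (NADM.Q m M)) ≤
          NADM.risk c μ T τ := by
  let S : NADM.Setting 𝒳 := ⟨m, σ, p, c, F₀, F₁, hm, hσ0, hσ1, hp0, hp1, hc, ‹_›, ‹_›⟩
  refine ⟨S.threshold N, S.threshold_mem_Icc N, fun ρ ρ' q hq => S.threshold_congr ρ ρ' hq, ?_⟩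
  intro ρ hρ Ω _ μ _ T M X h
  have h' : NADM.IsModel S.m S.σ S.p ρ S.F₀ S.F₁ μ T M X := h
  set ℱ := NADM.information (m := m) h.measurable_M h.measurable_X with hℱ
  have hle_cost : ∀ k, MeasurableSet[ℱ k]
      {ω | S.threshold N ρ (NADM.Q m M k ω) ≤ NADM.posterior μ T ℱ k ω} := by
    intro k
    have h1 : Measurable[ℱ k] fun ω => S.threshold N ρ (NADM.Q m M k ω) :=
      (measurable_of_countable (S.threshold N ρ)).comp
        (measurable_fst.comp (NADM.measurable_Z_information h.measurable_M h.measurable_X k))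
    have h2 : Measurable[ℱ k] (NADM.posterior μ T ℱ k) := stronglyMeasurable_condExp.measurable
    have h3 := h1.prodMk h2
    exact h3 measurableSet_le'
  refine ⟨fun i => ?_, fun τ hτ => ?_⟩
  · have hset : {ω | NADM.thresholdRule (S.threshold N ρ) (NADM.posterior μ T ℱ) (NADM.Q m M) ω ≤ i} =
        ⋃ k, ⋃ (_ : k ≤ i),
          {ω | S.threshold N ρ (NADM.Q m M k ω) ≤ NADM.posterior μ T ℱ k ω} := by
      ext ω
      simp only [Set.mem_iUnion, exists_prop]
      exact NADM.thresholdRule_le_iff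
    have := @MeasurableSet.iUnion Ω ℕ (ℱ i) _ (fun k => ⋃ (_ : k ≤ i),
      {ω | S.threshold N ρ (NADM.Q m M k ω) ≤ NADM.posterior μ T ℱ k ω}) fun k =>
        @MeasurableSet.iUnion Ω (k ≤ i) (ℱ i) _ _ fun hk => ℱ.mono hk _ (hle_cost k)
    exact hset ▸ this
  -- The optimal value at time 0 separates the two risks.
  · refine le_trans ?_ (NADM.Setting.lintegral_value_le_risk h' hρ.2 hτ)
    have hex : ∀ k : ℕ, ∃ A : Set (NADM.Hist N 𝒳 k), MeasurableSet A ∧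
        NADM.observe m M X k ⁻¹' A =
          {ω | S.threshold N ρ (NADM.Q m M k ω) ≤ NADM.posterior μ T ℱ k ω} := fun k => by
      have := hle_cost k
      rw [hℱ, NADM.information_eq_comap_observe] at this
      exact this
    choose A hA hAeq using hex
    have hmem : ∀ ω k, NADM.observe m M X k ω ∈ A k ↔
        S.threshold N ρ (NADM.Q m M k ω) ≤ NADM.posterior μ T ℱ k ω := fun ω k => by
      rw [← Set.mem_preimage, hAeq]
      rfl
    refine NADM.Setting.risk_le_lintegral_value h' hρ.2 hA (fun ω k => ?_) fun k => ?_
    · rw [NADM.thresholdRule_le_iff]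
      simp only [← hmem]
      rfl
    · filter_upwards [NADM.Setting.ae_threshold_le_iff hN h' hρ k] with ω hω hal
      refine (hmem ω k).trans (hω fun j hj => ?_)
      exact fun hle => NADM.observe_mem_alive.1 hal j hj ((hmem ω j).2 hle)
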